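/- There is an absolute constant $C>0$ such that the following holds. Let $n\ge 1$ and let $A$ be the adjacency matrix of a random graph drawn from the inhomogeneous Erdős–Rényi model $G(n,(p_{ij}))$, that is, $A$ is a random symmetric $n\times n$ matrix with entries in $\{0,1\}$ whose entries on and above the diagonal are independent, with $\mathbb{P}(A_{ij}=1)=p_{ij}$ for all $i,j$ (graphs without self-loops correspond to $p_{ii}=0$). Let $d=\max_{i,j} n p_{ij}$. For $\tau>0$ put $A_\tau=A+\frac{\tau}{n}\mathbf{1}\mathbf{1}^{\mathsf T}$, where $\mathbf 1$ is the all-ones vector. For a matrix $M$ with positive row sums $d_i=\sum_{j} M_{ij}$ let $\mathcal{L}(M)=D^{-1/2}MD^{-1/2}$ with $D=\operatorname{diag}(d_1,\dots,d_n)$, and let $\|\cdot\|$ be the spectral norm. Then for every $\tau>0$ and every $r\ge 1$, with probability at least $1-e^{-r}$, $$ \|\mathcal{L}(A_\tau)-\mathcal{L}(\mathbb{E}A_\tau)\|\le \frac{C r^2}{\sqrt{\tau}}\Big(1+\frac{d}{\tau}\Big)^{5/2}. $$ -/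

import Mathlib

open MeasureTheory ProbabilityTheory

noncomputable section

namespace RegLap

/-- The random matrix `A` is the adjacency matrix of a random graph on `n` vertices drawn from the
inhomogeneous Erdős–Rényi model `G(n, (p i j))`: it is symmetric with entries in `{0, 1}`, the
entries on and above the diagonal are independent, and `A i j = 1` with probability `p i j`.
Graphs without self-loops are the case `p i i = 0`. -/
structure IsInhomogeneousER {Ω : Type*} [MeasurableSpace Ω] (μ : Measure Ω) {n : ℕ}
    (p : Matrix (Fin n) (Fin n) ℝ) (A : Ω → Matrix (Fin n) (Fin n) ℝ) : Prop where
  measurable : ∀ i j, Measurable fun ω => A ω i j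
  binary : ∀ ω i j, A ω i j = 0 ∨ A ω i j = 1
  symm : ∀ ω, (A ω).IsSymm
  prob : ∀ i j, μ.real {ω | A ω i j = 1} = p i j
  indep : iIndepFun
    (fun (e : {e : Fin n × Fin n // e.1 ≤ e.2}) (ω : Ω) => A ω e.1.1 e.1.2) μ

/-- `d = max_{i,j} n p_{ij}`. -/
def maxDeg {n : ℕ} (p : Matrix (Fin n) (Fin n) ℝ) : ℝ :=
  ⨆ e : Fin n × Fin n, (n : ℝ) * p e.1 e.2

/-- The regularized matrix `M_τ = M + (τ / n) 1 1ᵀ`. -/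
def regularize {n : ℕ} (τ : ℝ) (M : Matrix (Fin n) (Fin n) ℝ) : Matrix (Fin n) (Fin n) ℝ :=
  M + (τ / n) • Matrix.vecMulVec 1 1

/-- The degree `d_i = ∑_j M_{ij}`. -/
def degree {n : ℕ} (M : Matrix (Fin n) (Fin n) ℝ) (i : Fin n) : ℝ := ∑ j, M i j

/-- The symmetric normalized Laplacian `D^{-1/2} M D^{-1/2}` with `D = diag(d_i)`. -/
def laplacian {n : ℕ} (M : Matrix (Fin n) (Fin n) ℝ) : Matrix (Fin n) (Fin n) ℝ :=
  Matrix.diagonal (fun i => degree M i ^ (-(1 / 2) : ℝ)) * M *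
    Matrix.diagonal (fun i => degree M i ^ (-(1 / 2) : ℝ))

/-- The entrywise expectation of a random matrix. -/
def expectation {Ω : Type*} [MeasurableSpace Ω] (μ : Measure Ω) {n : ℕ}
    (X : Ω → Matrix (Fin n) (Fin n) ℝ) : Matrix (Fin n) (Fin n) ℝ :=
  Matrix.of fun i j => ∫ ω, X ω i j ∂μ

/-- The spectral norm, that is, the operator norm on Euclidean space. -/
def specNorm {n : ℕ} (M : Matrix (Fin n) (Fin n) ℝ) : ℝ :=
  ‖Matrix.toEuclideanCLM (n := Fin n) (𝕜 := ℝ) M‖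

end RegLap

end

/-!
The expected degree of a vertex is at most `d`, but in the sparse regime the actual degrees are
unbounded, and then `A - 𝔼 A` is not of order `√d` in the spectral norm. It is of order `√(d + τ)`
with respect to the norm `√(∑ i, g i * x i ^ 2)` whose weight `g i` is `1` plus a multiple of the
degree of `i`. By a net argument it suffices to bound the bilinear form on lattice points of a ball,
in the manner of Kahn–Szemerédi and Feige–Ofek. The light couples, those with `|a i * b j|` at most
a constant times `√(d + τ)`, obey a Chernoff bound which survives a union bound over the lattice
points. The heavy couples are controlled by the edge discrepancy between all pairs of vertex sets,
except where one coordinate is much larger than the other; there one uses `∑ i, degree i * a i ^ 2`,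
which is exactly what the weights `g` control, so no high-degree vertex has to be removed.

Since the degrees of the regularized graph are at least `τ * g i`, multiplying by `D ^ (-1/2)` turns
the weighted norm into the Euclidean one. Testing the weighted bound on the constant vector shows
that the degrees are close to the expected degrees in an `ℓ²` sense, which bounds the effect of
replacing `D` by its expectation.
-/

namespace RegLap

open Finset Matrix

section WeightedForm

variable {ι : Type*} [Fintype ι] {g g' : ι → ℝ} {M : Matrix ι ι ℝ} {c κ : ℝ}

/-- The weighted Euclidean norm `(∑ i, g i * w i ^ 2) ^ (1 / 2)`. In the application `g i` is
proportional to a regularized degree. -/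
noncomputable def weightedNorm (g w : ι → ℝ) : ℝ := √(∑ i, g i * w i ^ 2)

/-- The bilinear form of `M` has operator norm at most `c` with respect to `weightedNorm g`. -/
def FormBound (g : ι → ℝ) (c : ℝ) (M : Matrix ι ι ℝ) : Prop :=
  ∀ w z : ι → ℝ, w ⬝ᵥ M *ᵥ z ≤ c * weightedNorm g w * weightedNorm g z

lemma weightedNorm_nonneg (g w : ι → ℝ) : 0 ≤ weightedNorm g w := Real.sqrt_nonneg _

lemma sq_weightedNorm (hg : ∀ i, 0 ≤ g i) (w : ι → ℝ) :
    weightedNorm g w ^ 2 = ∑ i, g i * w i ^ 2 :=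
  Real.sq_sqrt (sum_nonneg fun i _ => mul_nonneg (hg i) (sq_nonneg _))

lemma weightedNorm_smul (g w : ι → ℝ) (t : ℝ) :
    weightedNorm g (t • w) = |t| * weightedNorm g w := by
  simp only [weightedNorm, Pi.smul_apply, smul_eq_mul, mul_pow, mul_left_comm (g _), ← mul_sum]
  rw [Real.sqrt_mul (sq_nonneg t), Real.sqrt_sq_eq_abs]

lemma weightedNorm_one (w : ι → ℝ) : weightedNorm 1 w = ‖WithLp.toLp 2 w‖ := by
  simp [weightedNorm, EuclideanSpace.norm_eq]

lemma norm_toEuclideanCLM_le_iff [DecidableEq ι] (hc : 0 ≤ c) :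
    ‖toEuclideanCLM (n := ι) (𝕜 := ℝ) M‖ ≤ c ↔ FormBound 1 c M := by
  have inner_eq (w z : ι → ℝ) : w ⬝ᵥ M *ᵥ z =
      inner ℝ (WithLp.toLp 2 w) (toEuclideanCLM (n := ι) (𝕜 := ℝ) M (WithLp.toLp 2 z)) :=
    (inner_toEuclideanCLM M _ _).symm
  constructor
  · intro h w z
    rw [inner_eq, weightedNorm_one, weightedNorm_one]
    calc _ ≤ ‖WithLp.toLp 2 w‖ * ‖toEuclideanCLM (n := ι) (𝕜 := ℝ) M (WithLp.toLp 2 z)‖ :=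
          real_inner_le_norm _ _
      _ ≤ ‖WithLp.toLp 2 w‖ * (c * ‖WithLp.toLp 2 z‖) := by
          gcongr
          exact ContinuousLinearMap.le_of_opNorm_le _ h _
      _ = c * ‖WithLp.toLp 2 w‖ * ‖WithLp.toLp 2 z‖ := by ring
  · intro h
    refine ContinuousLinearMap.opNorm_le_of_re_inner_le hc fun x y hx hy => ?_
    simpa [inner_eq, weightedNorm_one, hx, hy, real_inner_comm] using h y.ofLp x.ofLp

namespace FormBound

lemma of_forall_weightedNorm_eq_one (hg : ∀ i, 0 < g i)
    (h : ∀ w z, weightedNorm g w = 1 → weightedNorm g z = 1 → w ⬝ᵥ M *ᵥ z ≤ c) :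
    FormBound g c M := by
  have zero : weightedNorm g 0 = 0 := by simp [weightedNorm]
  have eq_zero {w : ι → ℝ} (hw : weightedNorm g w = 0) : w = 0 := by
    have hsum : ∑ i, g i * w i ^ 2 = 0 := by
      rw [← sq_weightedNorm (fun i => (hg i).le), hw, zero_pow two_ne_zero]
    rw [sum_eq_zero_iff_of_nonneg fun i _ => mul_nonneg (hg i).le (sq_nonneg _)] at hsum
    ext i
    simpa [(hg i).ne'] using hsum i (mem_univ i)
  have unit {w : ι → ℝ} (hw : weightedNorm g w ≠ 0) :
      weightedNorm g ((weightedNorm g w)⁻¹ • w) = 1 := by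
    rw [weightedNorm_smul, abs_inv, abs_of_nonneg (weightedNorm_nonneg g w), inv_mul_cancel₀ hw]
  intro w z
  obtain hw | hw := eq_or_ne (weightedNorm g w) 0
  · simp [zero, eq_zero hw]
  obtain hz | hz := eq_or_ne (weightedNorm g z) 0
  · simp [zero, eq_zero hz]
  have hw' := (weightedNorm_nonneg g w).lt_of_ne' hw
  have hz' := (weightedNorm_nonneg g z).lt_of_ne' hz
  have := h _ _ (unit hw) (unit hz)
  rw [mulVec_smul, dotProduct_smul, smul_dotProduct, smul_eq_mul, smul_eq_mul,
    inv_mul_le_iff₀ hz', inv_mul_le_iff₀ hw'] at this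
  linarith

lemma diagonal_mul_mul_diagonal [DecidableEq ι] (h : FormBound g c M) (hc : 0 ≤ c)
    (hκ : 0 ≤ κ) {α : ι → ℝ} (hα : ∀ i, g i * α i ^ 2 ≤ κ * g' i) :
    FormBound g' (c * κ) (diagonal α * M * diagonal α) := by
  have bound (w : ι → ℝ) : weightedNorm g (α * w) ≤ √κ * weightedNorm g' w := by
    rw [weightedNorm, weightedNorm, ← Real.sqrt_mul hκ, mul_sum]
    refine Real.sqrt_le_sqrt (sum_le_sum fun i _ => ?_)
    rw [Pi.mul_apply, mul_pow, ← mul_assoc, ← mul_assoc]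
    exact mul_le_mul_of_nonneg_right (hα i) (sq_nonneg _)
  intro w z
  calc w ⬝ᵥ (diagonal α * M * diagonal α) *ᵥ z = (α * w : ι → ℝ) ⬝ᵥ M *ᵥ (α * z : ι → ℝ) := by
        simp only [dotProduct, mulVec, mul_diagonal, diagonal_mul, Pi.mul_apply, mul_sum]
        exact sum_congr rfl fun i _ => sum_congr rfl fun j _ => by ring
    _ ≤ c * weightedNorm g (α * w) * weightedNorm g (α * z) := h _ _
    _ ≤ c * (√κ * weightedNorm g' w) * (√κ * weightedNorm g' z) := by
        have := weightedNorm_nonneg g (α * z)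
        have := weightedNorm_nonneg g' w
        gcongr
        exacts [bound w, bound z]
    _ = c * (√κ * √κ) * weightedNorm g' w * weightedNorm g' z := by ring
    _ = c * κ * weightedNorm g' w * weightedNorm g' z := by rw [Real.mul_self_sqrt hκ]

end FormBound

lemma exists_isLeast_formBound (hg : ∀ i, 0 < g i) (M : Matrix ι ι ℝ) :
    ∃ c, IsLeast {c | 0 ≤ c ∧ FormBound g c M} c := by
  classical
  set N := diagonal (fun i => (√(g i))⁻¹) * M * diagonal (fun i => (√(g i))⁻¹) with hN
  have hM : M = diagonal (fun i => √(g i)) * N * diagonal (fun i => √(g i)) := by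
    ext i j
    have hi := (Real.sqrt_pos.2 (hg i)).ne'
    have hj := (Real.sqrt_pos.2 (hg j)).ne'
    simp only [hN, mul_diagonal, diagonal_mul]
    field_simp
  have iff {c : ℝ} (hc : 0 ≤ c) : FormBound g c M ↔ FormBound 1 c N := by
    constructor <;> intro h
    · simpa using h.diagonal_mul_mul_diagonal (g' := 1) hc zero_le_one fun i => by
        simp [Real.sq_sqrt (hg i).le, (hg i).ne']
    · rw [hM]
      simpa using h.diagonal_mul_mul_diagonal (g' := g) hc zero_le_one fun i => by
        simp [Real.sq_sqrt (hg i).le]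
  refine ⟨‖toEuclideanCLM (n := ι) (𝕜 := ℝ) N‖, ⟨norm_nonneg _, ?_⟩, fun c ⟨hc, h⟩ => ?_⟩
  · rw [iff (norm_nonneg _), ← norm_toEuclideanCLM_le_iff (norm_nonneg _)]
  · rwa [norm_toEuclideanCLM_le_iff hc, ← iff hc]

lemma exists_int_sq_le (t : ℝ) : ∃ k : ℤ, (k : ℝ) ^ 2 ≤ t ^ 2 ∧ (t - k) ^ 2 ≤ 1 := by
  obtain ht | ht := le_total 0 t
  · have floor_le := Int.floor_le t
    have lt_floor_add_one := Int.lt_floor_add_one t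
    have : (0 : ℝ) ≤ ⌊t⌋ := by exact_mod_cast Int.floor_nonneg.2 ht
    exact ⟨⌊t⌋, by gcongr, by nlinarith⟩
  · have le_ceil := Int.le_ceil t
    have ceil_lt_add_one := Int.ceil_lt_add_one t
    have : (⌈t⌉ : ℝ) ≤ 0 := by exact_mod_cast Int.ceil_nonpos.2 ht
    exact ⟨⌈t⌉, by nlinarith, by nlinarith⟩

lemma exists_lattice_approx (hg : ∀ i, 0 ≤ g i) {R : ℝ} (hR : 0 < R) (hgR : 16 * ∑ i, g i ≤ R)
    {w : ι → ℝ} (hw : weightedNorm g w ≤ 1) :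
    ∃ a : ι → ℤ, ∑ i, g i * (a i : ℝ) ^ 2 ≤ R ∧
      weightedNorm g (w - (√R)⁻¹ • fun i => (a i : ℝ)) ≤ 1 / 4 := by
  choose a ha_sq ha_sub using fun i => exists_int_sq_le (√R * w i)
  have hR' : 0 < √R := Real.sqrt_pos.2 hR
  have hw_sq : ∑ i, g i * w i ^ 2 ≤ 1 := by
    rw [← sq_weightedNorm hg]
    exact pow_le_one₀ (weightedNorm_nonneg g w) hw
  refine ⟨a, ?_, ?_⟩
  · calc ∑ i, g i * (a i : ℝ) ^ 2 ≤ ∑ i, g i * (√R * w i) ^ 2 :=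
          sum_le_sum fun i _ => mul_le_mul_of_nonneg_left (ha_sq i) (hg i)
      _ = R * ∑ i, g i * w i ^ 2 := by
          simp only [mul_pow, Real.sq_sqrt hR.le, mul_left_comm (g _), mul_sum]
      _ ≤ R := mul_le_of_le_one_right hR.le hw_sq
  · rw [weightedNorm, Real.sqrt_le_left (by norm_num)]
    calc ∑ i, g i * (w - (√R)⁻¹ • fun i => (a i : ℝ)) i ^ 2
        = ∑ i, g i * (√R * w i - a i) ^ 2 / R := by
          refine sum_congr rfl fun i _ => ?_
          rw [← Real.sq_sqrt hR.le, mul_div_assoc, ← div_pow, Real.sqrt_sq hR'.le, sub_div,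
            mul_div_cancel_left₀ _ hR'.ne', Pi.sub_apply, Pi.smul_apply, smul_eq_mul,
            div_eq_inv_mul]
      _ ≤ ∑ i, g i * 1 / R := sum_le_sum fun i _ => by
          gcongr
          exacts [hg i, ha_sub i]
      _ = (∑ i, g i) / R := by simp only [mul_one, sum_div]
      _ ≤ (1 / 4) ^ 2 := by
          rw [div_le_iff₀ hR]
          linarith

/-- Rounding the test vectors to the lattice turns any bound `c` into `Q + c / 2`; the least
bound therefore is at most `2 * Q`. -/
lemma FormBound.of_lattice (hg : ∀ i, 0 < g i) {R Q : ℝ} (hR : 0 < R)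
    (hgR : 16 * ∑ i, g i ≤ R)
    (h : ∀ a b : ι → ℤ, ∑ i, g i * (a i : ℝ) ^ 2 ≤ R → ∑ i, g i * (b i : ℝ) ^ 2 ≤ R →
      (fun i => (a i : ℝ)) ⬝ᵥ M *ᵥ (fun i => (b i : ℝ)) ≤ R * Q) :
    FormBound g (2 * Q) M := by
  obtain ⟨c, ⟨hc, hcM⟩, hc_least⟩ := exists_isLeast_formBound hg M
  have hg' i := (hg i).le
  have hQ : 0 ≤ Q := by
    have := h 0 0 (by simpa using hR.le) (by simpa using hR.le)
    refine nonneg_of_mul_nonneg_right ?_ hR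
    simpa using this
  have hR' : 0 < √R := Real.sqrt_pos.2 hR
  have improve : FormBound g (Q + c / 2) M := by
    refine .of_forall_weightedNorm_eq_one hg fun w z hw hz => ?_
    obtain ⟨a, ha, hwa⟩ := exists_lattice_approx hg' hR hgR hw.le
    obtain ⟨b, hb, hzb⟩ := exists_lattice_approx hg' hR hgR hz.le
    set u := (√R)⁻¹ • fun i => (a i : ℝ) with hu
    set v := (√R)⁻¹ • fun i => (b i : ℝ) with hv
    have hu_norm : weightedNorm g u ≤ 1 := by
      rw [hu, weightedNorm_smul, abs_of_pos (inv_pos.2 hR'), inv_mul_le_iff₀ hR', mul_one]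
      exact Real.sqrt_le_sqrt ha
    have main : u ⬝ᵥ M *ᵥ v ≤ Q := by
      rw [hu, hv, mulVec_smul, dotProduct_smul, smul_dotProduct, smul_eq_mul, smul_eq_mul,
        inv_mul_le_iff₀ hR', inv_mul_le_iff₀ hR', ← mul_assoc, Real.mul_self_sqrt hR.le]
      exact h a b ha hb
    have left : (w - u) ⬝ᵥ M *ᵥ z ≤ c * (1 / 4) * 1 :=
      (hcM _ _).trans (by rw [hz]; gcongr)
    have right : u ⬝ᵥ M *ᵥ (z - v) ≤ c * 1 * (1 / 4) :=
      (hcM _ _).trans (by gcongr; exact weightedNorm_nonneg _ _)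
    calc w ⬝ᵥ M *ᵥ z = u ⬝ᵥ M *ᵥ v + (w - u) ⬝ᵥ M *ᵥ z + u ⬝ᵥ M *ᵥ (z - v) := by
          rw [sub_dotProduct, mulVec_sub, dotProduct_sub]
          ring
      _ ≤ Q + c / 2 := by linarith
  have hc_le : c ≤ Q + c / 2 := hc_least ⟨by positivity, improve⟩
  intro w z
  refine (hcM w z).trans ?_
  gcongr
  exacts [weightedNorm_nonneg _ _, weightedNorm_nonneg _ _, by linarith]

/-- Test against the row sums divided by `g` and the all-ones vector. -/
lemma FormBound.sum_sq_rowSum_div_le (hg : ∀ i, 0 < g i) (hc : 0 ≤ c) (h : FormBound g c M) :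
    ∑ i, (∑ j, M i j) ^ 2 / g i ≤ c ^ 2 * ∑ i, g i := by
  set S := ∑ i, (∑ j, M i j) ^ 2 / g i with hS
  have hS0 : 0 ≤ S := sum_nonneg fun i _ => div_nonneg (sq_nonneg _) (hg i).le
  have hw : weightedNorm g (fun i => (∑ j, M i j) / g i) = √S := by
    rw [weightedNorm, hS]
    congr 1
    refine sum_congr rfl fun i _ => ?_
    have := (hg i).ne'
    field_simp
  have hG : 0 ≤ ∑ i, g i := sum_nonneg fun i _ => (hg i).le
  have key : S ≤ c * √S * √(∑ i, g i) := by
    have := h (fun i => (∑ j, M i j) / g i) 1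
    rw [hw] at this
    simpa [weightedNorm, dotProduct, mulVec, hS, div_mul_eq_mul_div, sq] using this
  have hsqrt : √S ≤ c * √(∑ i, g i) := by
    obtain h0 | h0 := (Real.sqrt_nonneg S).eq_or_lt
    · rw [← h0]
      positivity
    · refine le_of_mul_le_mul_left ?_ h0
      rw [Real.mul_self_sqrt hS0]
      linarith
  calc S = √S ^ 2 := (Real.sq_sqrt hS0).symm
    _ ≤ (c * √(∑ i, g i)) ^ 2 := by gcongr
    _ = c ^ 2 * ∑ i, g i := by rw [mul_pow, Real.sq_sqrt hG]

lemma formBound_rowSum (hM : ∀ i j, 0 ≤ M i j) (hsymm : M.IsSymm) :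
    FormBound (fun i => ∑ j, M i j) 1 M := by
  intro w z
  have row (w : ι → ℝ) : ∑ x : ι × ι, (√(M x.1 x.2) * w x.1) ^ 2 =
      ∑ i, (∑ j, M i j) * w i ^ 2 := by
    simp only [mul_pow, Real.sq_sqrt (hM _ _), Fintype.sum_prod_type, sum_mul]
  have col (w : ι → ℝ) : ∑ x : ι × ι, (√(M x.1 x.2) * w x.2) ^ 2 =
      ∑ i, (∑ j, M i j) * w i ^ 2 := by
    rw [← row, ← (Equiv.prodComm ι ι).sum_comp]
    simp only [Equiv.prodComm_apply, Prod.fst_swap, Prod.snd_swap, hsymm.apply]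
  calc w ⬝ᵥ M *ᵥ z
      = ∑ x : ι × ι, (√(M x.1 x.2) * w x.1) * (√(M x.1 x.2) * z x.2) := by
        simp only [dotProduct, mulVec, mul_sum, Fintype.sum_prod_type]
        refine sum_congr rfl fun i _ => sum_congr rfl fun j _ => ?_
        rw [mul_mul_mul_comm, Real.mul_self_sqrt (hM i j)]
        ring
    _ ≤ √(∑ x : ι × ι, (√(M x.1 x.2) * w x.1) ^ 2) *
          √(∑ x : ι × ι, (√(M x.1 x.2) * z x.2) ^ 2) := Real.sum_mul_le_sqrt_mul_sqrt _ _ _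
    _ = _ := by rw [row, col, one_mul, weightedNorm, weightedNorm]

lemma norm_toEuclideanCLM_le_frobenius [DecidableEq ι] (M : Matrix ι ι ℝ) :
    ‖toEuclideanCLM (n := ι) (𝕜 := ℝ) M‖ ≤ √(∑ i, ∑ j, M i j ^ 2) := by
  rw [norm_toEuclideanCLM_le_iff (Real.sqrt_nonneg _)]
  intro w z
  have hw : 0 ≤ ∑ i, w i ^ 2 := sum_nonneg fun i _ => sq_nonneg _
  calc w ⬝ᵥ M *ᵥ z = ∑ x : ι × ι, M x.1 x.2 * (w x.1 * z x.2) := by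
        simp only [dotProduct, mulVec, mul_sum, Fintype.sum_prod_type]
        exact sum_congr rfl fun i _ => sum_congr rfl fun j _ => by ring
    _ ≤ √(∑ x : ι × ι, M x.1 x.2 ^ 2) * √(∑ x : ι × ι, (w x.1 * z x.2) ^ 2) :=
        Real.sum_mul_le_sqrt_mul_sqrt _ _ _
    _ = √(∑ i, ∑ j, M i j ^ 2) * weightedNorm 1 w * weightedNorm 1 z := by
        simp only [mul_pow, Fintype.sum_prod_type, ← sum_mul_sum, weightedNorm, Pi.one_apply,
          one_mul]
        rw [Real.sqrt_mul hw, mul_assoc]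

lemma norm_diagonal_mul_mul_diagonal_le [DecidableEq ι] (hc : 0 ≤ c) (hM : ∀ i j, |M i j| ≤ c)
    (α β : ι → ℝ) :
    ‖toEuclideanCLM (n := ι) (𝕜 := ℝ) (diagonal α * M * diagonal β)‖ ≤
      c * (√(∑ i, α i ^ 2) * √(∑ i, β i ^ 2)) := by
  refine (norm_toEuclideanCLM_le_frobenius _).trans ?_
  rw [← Real.sqrt_mul (sum_nonneg fun i _ => sq_nonneg _), Real.sqrt_le_left (by positivity),
    mul_pow, Real.sq_sqrt (by positivity), sum_mul_sum, mul_sum]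
  refine sum_le_sum fun i _ => ?_
  rw [mul_sum]
  refine sum_le_sum fun j _ => ?_
  have hij : M i j ^ 2 ≤ c ^ 2 := sq_le_sq.2 ((hM i j).trans (le_abs_self c))
  rw [mul_diagonal, diagonal_mul, mul_pow, mul_pow]
  calc α i ^ 2 * M i j ^ 2 * β j ^ 2 ≤ α i ^ 2 * c ^ 2 * β j ^ 2 := by gcongr
    _ = c ^ 2 * (α i ^ 2 * β j ^ 2) := by ring

end WeightedForm

section Laplacian

variable {n : ℕ} {M N : Matrix (Fin n) (Fin n) ℝ} {τ : ℝ}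

lemma regularize_apply (τ : ℝ) (M : Matrix (Fin n) (Fin n) ℝ) (i j : Fin n) :
    regularize τ M i j = M i j + τ / n := by
  simp [regularize]

lemma degree_regularize (τ : ℝ) (M : Matrix (Fin n) (Fin n) ℝ) (i : Fin n) :
    degree (regularize τ M) i = degree M i + τ := by
  have : (n : ℝ) ≠ 0 := Nat.cast_ne_zero.2 i.pos.ne'
  simp only [degree, regularize_apply, sum_add_distrib, sum_const, card_univ, Fintype.card_fin,
    nsmul_eq_mul, mul_div_cancel₀ _ this]

lemma regularize_nonneg (hτ : 0 ≤ τ) (hM : ∀ i j, 0 ≤ M i j) (i j : Fin n) :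
    0 ≤ regularize τ M i j := by
  rw [regularize_apply]
  exact add_nonneg (hM i j) (by positivity)

lemma isSymm_regularize (hM : M.IsSymm) : (regularize τ M).IsSymm :=
  IsSymm.ext fun i j => by rw [regularize_apply, regularize_apply, hM.apply]

lemma regularize_sub_regularize (τ : ℝ) (M N : Matrix (Fin n) (Fin n) ℝ) :
    regularize τ M - regularize τ N = M - N :=
  add_sub_add_right_eq_sub _ _ _

lemma degree_nonneg (hM : ∀ i j, 0 ≤ M i j) (i : Fin n) : 0 ≤ degree M i :=
  sum_nonneg fun j _ => hM i j

lemma sq_rpow_neg_half {x : ℝ} (hx : 0 ≤ x) : (x ^ (-(1 / 2) : ℝ)) ^ 2 = x⁻¹ := by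
  rw [← Real.rpow_natCast, ← Real.rpow_mul hx]
  norm_num [Real.rpow_neg_one]

lemma sq_rpow_neg_half_sub_le {a b : ℝ} (ha : 0 < a) (hb : 0 < b) :
    (a ^ (-(1 / 2) : ℝ) - b ^ (-(1 / 2) : ℝ)) ^ 2 ≤ (a - b) ^ 2 / (a ^ 2 * b) := by
  set u := a ^ (-(1 / 2) : ℝ) with hu
  set v := b ^ (-(1 / 2) : ℝ) with hv
  have hu0 : 0 < u := Real.rpow_pos_of_pos ha _
  have hv0 : 0 < v := Real.rpow_pos_of_pos hb _
  have hau : a = (u ^ 2)⁻¹ := by rw [hu, sq_rpow_neg_half ha.le, inv_inv]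
  have hbv : b = (v ^ 2)⁻¹ := by rw [hv, sq_rpow_neg_half hb.le, inv_inv]
  calc (u - v) ^ 2 = (u - v) ^ 2 * v ^ 2 / v ^ 2 := by field_simp
    _ ≤ (u - v) ^ 2 * (u + v) ^ 2 / v ^ 2 := by
        gcongr
        linarith
    _ = (a - b) ^ 2 / (a ^ 2 * b) := by
        rw [hau, hbv]
        field_simp
        ring

/-- The diagonal of `D ^ (-1 / 2)`, where `D` is the degree matrix of `M`. -/
noncomputable def invSqrtDegree (M : Matrix (Fin n) (Fin n) ℝ) (i : Fin n) : ℝ :=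
  degree M i ^ (-(1 / 2) : ℝ)

lemma sq_invSqrtDegree {i : Fin n} (h : 0 ≤ degree M i) :
    invSqrtDegree M i ^ 2 = (degree M i)⁻¹ :=
  sq_rpow_neg_half h

lemma laplacian_eq (M : Matrix (Fin n) (Fin n) ℝ) :
    laplacian M = diagonal (invSqrtDegree M) * M * diagonal (invSqrtDegree M) :=
  rfl

lemma specNorm_laplacian_le_one (hM : ∀ i j, 0 ≤ M i j) (hsymm : M.IsSymm) :
    specNorm (laplacian M) ≤ 1 := by
  refine (norm_toEuclideanCLM_le_iff zero_le_one).2 ?_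
  have schur : FormBound (degree M) 1 M := formBound_rowSum hM hsymm
  have := schur.diagonal_mul_mul_diagonal (g' := 1) (α := invSqrtDegree M) zero_le_one
    zero_le_one fun i => by
      rw [sq_invSqrtDegree (degree_nonneg hM i), Pi.one_apply, mul_one]
      exact mul_inv_le_one
  rwa [laplacian_eq, ← mul_one (1 : ℝ)]

lemma specNorm_laplacian_sub_laplacian_le_two (hM : ∀ i j, 0 ≤ M i j) (hMs : M.IsSymm)
    (hN : ∀ i j, 0 ≤ N i j) (hNs : N.IsSymm) : specNorm (laplacian M - laplacian N) ≤ 2 := by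
  calc specNorm (laplacian M - laplacian N) ≤ specNorm (laplacian M) + specNorm (laplacian N) := by
        simpa only [specNorm, map_sub] using norm_sub_le _ _
    _ ≤ 2 := by linarith [specNorm_laplacian_le_one hM hMs, specNorm_laplacian_le_one hN hNs]

lemma laplacian_sub_laplacian (M N : Matrix (Fin n) (Fin n) ℝ) :
    laplacian M - laplacian N =
      diagonal (invSqrtDegree M) * (M - N) * diagonal (invSqrtDegree M) +
        diagonal (invSqrtDegree M - invSqrtDegree N) * N * diagonal (invSqrtDegree M) +
        diagonal (invSqrtDegree N) * N * diagonal (invSqrtDegree M - invSqrtDegree N) := by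
  ext i j
  simp only [laplacian_eq, Matrix.sub_apply, Matrix.add_apply, mul_diagonal, diagonal_mul,
    Pi.sub_apply]
  ring

lemma sum_sq_invSqrtDegree_le {τ : ℝ} (hτ : 0 < τ) (hM : ∀ i, τ ≤ degree M i) :
    ∑ i, invSqrtDegree M i ^ 2 ≤ n / τ := calc
  ∑ i, invSqrtDegree M i ^ 2 ≤ ∑ _i : Fin n, τ⁻¹ := sum_le_sum fun i _ => by
    rw [sq_invSqrtDegree (hτ.le.trans (hM i))]
    exact inv_anti₀ hτ (hM i)
  _ = n / τ := by simp [div_eq_mul_inv]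

lemma sum_sq_invSqrtDegree_sub_le {g : Fin n → ℝ} {τ m : ℝ} (hτ : 0 < τ) (hm : 0 ≤ m)
    (hg : ∀ i, 1 ≤ g i) (hMg : ∀ i, τ * g i ≤ degree M i) (hN : ∀ i, τ ≤ degree N i)
    (h : FormBound g m (M - N)) :
    ∑ i, (invSqrtDegree M - invSqrtDegree N) i ^ 2 ≤ m ^ 2 * (∑ i, g i) / τ ^ 3 := by
  have hg0 i : 0 < g i := zero_lt_one.trans_le (hg i)
  have term (i : Fin n) : (invSqrtDegree M - invSqrtDegree N) i ^ 2 ≤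
      (∑ j, (M - N) i j) ^ 2 / g i / τ ^ 3 := by
    have hτg : 0 < τ * g i := mul_pos hτ (hg0 i)
    have hdeg : degree M i - degree N i = ∑ j, (M - N) i j := by
      simp only [degree, Matrix.sub_apply, sum_sub_distrib]
    have hden : g i * τ ^ 3 ≤ degree M i ^ 2 * degree N i := calc
      g i * τ ^ 3 ≤ g i ^ 2 * τ ^ 3 := by
        gcongr
        exact le_self_pow₀ (hg i) two_ne_zero
      _ = (τ * g i) ^ 2 * τ := by ring
      _ ≤ _ := by
        gcongr
        exacts [hMg i, hN i]
    refine (sq_rpow_neg_half_sub_le (hτg.trans_le (hMg i)) (hτ.trans_le (hN i))).trans ?_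
    rw [hdeg, div_div]
    exact div_le_div_of_nonneg_left (sq_nonneg _) (mul_pos (hg0 i) (by positivity)) hden
  calc ∑ i, (invSqrtDegree M - invSqrtDegree N) i ^ 2
      ≤ ∑ i, (∑ j, (M - N) i j) ^ 2 / g i / τ ^ 3 := sum_le_sum fun i _ => term i
    _ = (∑ i, (∑ j, (M - N) i j) ^ 2 / g i) / τ ^ 3 := by rw [sum_div]
    _ ≤ m ^ 2 * (∑ i, g i) / τ ^ 3 := by
        gcongr
        exact h.sum_sq_rowSum_div_le hg0 hm

lemma specNorm_diagonal_mul_mul_diagonal_le {α β : Fin n → ℝ} {δ κ : ℝ} (hδ : 0 ≤ δ) (hκ : 0 ≤ κ)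
    (hNδ : ∀ i j, |N i j| ≤ δ / n) (h : (∑ i, α i ^ 2) * ∑ i, β i ^ 2 ≤ (n * κ) ^ 2) :
    specNorm (diagonal α * N * diagonal β) ≤ δ * κ := by
  calc specNorm (diagonal α * N * diagonal β)
      ≤ δ / n * (√(∑ i, α i ^ 2) * √(∑ i, β i ^ 2)) :=
        norm_diagonal_mul_mul_diagonal_le (by positivity) hNδ α β
    _ ≤ δ / n * (n * κ) := by
        rw [← Real.sqrt_mul (sum_nonneg fun i _ => sq_nonneg _)]
        gcongr
        exact Real.sqrt_le_iff.2 ⟨by positivity, h⟩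
    _ = δ * κ * (n / n) := by ring
    _ ≤ δ * κ := mul_le_of_le_one_right (by positivity) (div_self_le_one _)

/-- A weighted form bound on `M - N` controls both the fluctuation of the entries and, through
the row sums, that of the degrees. -/
lemma specNorm_laplacian_sub_le {g : Fin n → ℝ} {τ δ m : ℝ} (hτ : 0 < τ) (hδ : 0 ≤ δ) (hm : 0 ≤ m)
    (hg : ∀ i, 1 ≤ g i) (hg_sum : ∑ i, g i ≤ 2 * n) (hMg : ∀ i, τ * g i ≤ degree M i)
    (hN : ∀ i, τ ≤ degree N i) (hNδ : ∀ i j, |N i j| ≤ δ / n) (h : FormBound g m (M - N)) :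
    specNorm (laplacian M - laplacian N) ≤ m / τ + 4 * δ * m / τ ^ 2 := by
  have hM i : τ ≤ degree M i := (le_mul_of_one_le_right hτ.le (hg i)).trans (hMg i)
  have entries : specNorm (diagonal (invSqrtDegree M) * (M - N) * diagonal (invSqrtDegree M)) ≤
      m / τ := by
    refine (norm_toEuclideanCLM_le_iff (by positivity)).2 ?_
    rw [div_eq_mul_inv]
    refine h.diagonal_mul_mul_diagonal hm (by positivity) fun i => ?_
    rw [sq_invSqrtDegree (hτ.le.trans (hM i)), Pi.one_apply, mul_one, ← div_eq_mul_inv,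
      div_le_iff₀ (hτ.trans_le (hM i)), inv_mul_eq_div, le_div_iff₀' hτ]
    exact hMg i
  have product_le {K : Matrix (Fin n) (Fin n) ℝ} (hK : ∀ i, τ ≤ degree K i) :
      (∑ i, (invSqrtDegree M - invSqrtDegree N) i ^ 2) * ∑ i, invSqrtDegree K i ^ 2 ≤
        (n * (2 * m / τ ^ 2)) ^ 2 := calc
    _ ≤ m ^ 2 * (2 * n) / τ ^ 3 * (n / τ) := by
        gcongr
        · exact (sum_sq_invSqrtDegree_sub_le hτ hm hg hMg hN h).trans (by gcongr)
        · exact sum_sq_invSqrtDegree_le hτ hK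
    _ = 2 * (n * m / τ ^ 2) ^ 2 := by field_simp
    _ ≤ 4 * (n * m / τ ^ 2) ^ 2 := by
        gcongr
        norm_num
    _ = (n * (2 * m / τ ^ 2)) ^ 2 := by ring
  have left := specNorm_diagonal_mul_mul_diagonal_le hδ (by positivity) hNδ (product_le hM)
  have right := specNorm_diagonal_mul_mul_diagonal_le hδ (by positivity) hNδ
    ((mul_comm _ _).trans_le (product_le hN))
  calc specNorm (laplacian M - laplacian N)
      ≤ m / τ + δ * (2 * m / τ ^ 2) + δ * (2 * m / τ ^ 2) := by
        rw [laplacian_sub_laplacian, specNorm, map_add, map_add]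
        exact norm_add₃_le.trans (by gcongr; exacts [entries, left, right])
    _ = m / τ + 4 * δ * m / τ ^ 2 := by ring

end Laplacian

section Entropy

variable {n s : ℕ}

/-- The upper bound `s * log (e * n / s)` for the logarithm of the number of `s`-subsets of an
`n`-set; it vanishes at `s = 0`. -/
noncomputable def subsetEntropy (n s : ℕ) : ℝ := s * (1 + Real.log (n / s))

lemma subsetEntropy_zero (n : ℕ) : subsetEntropy n 0 = 0 := by simp [subsetEntropy]

lemma subsetEntropy_nonneg (h : s ≤ n) : 0 ≤ subsetEntropy n s := by
  obtain rfl | hs := s.eq_zero_or_pos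
  · exact (subsetEntropy_zero n).ge
  · have : (1 : ℝ) ≤ n / s := (one_le_div (Nat.cast_pos.2 hs)).2 (Nat.cast_le.2 h)
    have := Real.log_nonneg this
    unfold subsetEntropy
    positivity

lemma subsetEntropy_le (hsn : s ≤ n) {y : ℝ} (hy : 0 < y) :
    subsetEntropy n s ≤ n * y + s * Real.log y⁻¹ := by
  obtain rfl | hs := s.eq_zero_or_pos
  · rw [subsetEntropy_zero, Nat.cast_zero, zero_mul, add_zero]
    positivity
  · have : (0 : ℝ) < n := Nat.cast_pos.2 (hs.trans_le hsn)
    have : (0 : ℝ) < s := Nat.cast_pos.2 hs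
    have log_le := Real.log_le_sub_one_of_pos (show 0 < n / s * y by positivity)
    rw [Real.log_mul (by positivity) hy.ne'] at log_le
    calc subsetEntropy n s ≤ s * (n / s * y - Real.log y) := by
          unfold subsetEntropy
          gcongr
          linarith
      _ = n * y + s * Real.log y⁻¹ := by
          rw [Real.log_inv]
          field_simp
          ring

lemma four_pow_mul_subsetEntropy_div_le (hsn : s ≤ n) (l : ℕ) :
    4 ^ l * subsetEntropy n s / (1 + l) ≤ 3 * ((4 : ℝ) ^ l * s) + n * (1 / 2) ^ l := by
  have log_eight : Real.log 8 ≤ 3 := by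
    rw [show (8 : ℝ) = 2 ^ 3 by norm_num, Real.log_pow]
    have := Real.log_two_lt_d9
    push_cast
    linarith
  have entropy_le : subsetEntropy n s ≤ n * (8 ^ l : ℝ)⁻¹ + s * (l * 3) := by
    refine (subsetEntropy_le hsn (y := (8 ^ l : ℝ)⁻¹) (by positivity)).trans ?_
    rw [inv_inv, Real.log_pow]
    gcongr
  have half_pow : (4 : ℝ) ^ l * (8 ^ l : ℝ)⁻¹ = (1 / 2) ^ l := by
    rw [← inv_pow, ← mul_pow]
    norm_num
  rw [div_le_iff₀ (by positivity)]
  calc 4 ^ l * subsetEntropy n s ≤ 4 ^ l * (n * (8 ^ l : ℝ)⁻¹ + s * (l * 3)) := by gcongr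
    _ = 3 * (4 ^ l * s) * l + n * (1 / 2) ^ l * 1 := by
        rw [← half_pow]
        ring
    _ ≤ 3 * (4 ^ l * s) * (1 + l) + n * (1 / 2) ^ l * (1 + l) := by
        gcongr <;> linarith [l.cast_nonneg (α := ℝ)]
    _ = (3 * (4 ^ l * s) + n * (1 / 2) ^ l) * (1 + l) := by ring

lemma sum_four_pow_mul_subsetEntropy_div_le {t : ℕ → ℕ} (ht : ∀ l, t l ≤ n) (N : ℕ) :
    ∑ l ∈ range N, 4 ^ l * subsetEntropy n (t l) / (1 + l) ≤
      3 * ∑ l ∈ range N, (4 : ℝ) ^ l * t l + 2 * n := calc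
  _ ≤ ∑ l ∈ range N, (3 * ((4 : ℝ) ^ l * t l) + n * (1 / 2) ^ l) :=
      sum_le_sum fun l _ => four_pow_mul_subsetEntropy_div_le (ht l) l
  _ = 3 * ∑ l ∈ range N, (4 : ℝ) ^ l * t l + n * ∑ l ∈ range N, (1 / 2 : ℝ) ^ l := by
      rw [sum_add_distrib, mul_sum, mul_sum]
  _ ≤ 3 * ∑ l ∈ range N, (4 : ℝ) ^ l * t l + n * 2 := by
      gcongr
      exact sum_geometric_two_le N
  _ = _ := by ring

lemma one_add_log_le_subsetEntropy (hs : 0 < s) (hsn : s ≤ n) :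
    1 + Real.log n ≤ subsetEntropy n s := by
  have hs' : (0 : ℝ) < s := Nat.cast_pos.2 hs
  have hn' : (0 : ℝ) < n := Nat.cast_pos.2 (hs.trans_le hsn)
  have log_s := Real.log_le_sub_one_of_pos hs'
  have log_div : 0 ≤ Real.log (n / s) :=
    Real.log_nonneg ((one_le_div hs').2 (Nat.cast_le.2 hsn))
  have one_le_s : (1 : ℝ) ≤ s := Nat.one_le_cast.2 hs
  calc 1 + Real.log n = 1 + Real.log s + Real.log (n / s) := by
        rw [Real.log_div hn'.ne' hs'.ne']
        ring
    _ ≤ s * 1 + s * Real.log (n / s) := by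
        gcongr
        · linarith
        · exact le_mul_of_one_le_left log_div one_le_s
    _ = subsetEntropy n s := by rw [subsetEntropy, mul_add]

lemma choose_mul_exp_neg_subsetEntropy_le (hsn : s ≤ n) :
    (n.choose s : ℝ) * Real.exp (-subsetEntropy n s) ≤ 1 := by
  obtain rfl | hs := s.eq_zero_or_pos
  · simp [subsetEntropy_zero]
  have hs' : (0 : ℝ) < s := Nat.cast_pos.2 hs
  have hn' : (0 : ℝ) < n := Nat.cast_pos.2 (hs.trans_le hsn)
  have exp_entropy : Real.exp (subsetEntropy n s) = Real.exp s * (n / s) ^ s := by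
    rw [subsetEntropy, mul_one_add, Real.exp_add, ← Real.log_pow,
      Real.exp_log (by positivity)]
  rw [Real.exp_neg, ← div_eq_mul_inv, div_le_one (Real.exp_pos _), exp_entropy]
  calc (n.choose s : ℝ) ≤ n ^ s / s.factorial := Nat.choose_le_pow_div s n
    _ = s ^ s / s.factorial * (n / s) ^ s := by
        rw [div_pow]
        field_simp
    _ ≤ Real.exp s * (n / s) ^ s := by
        gcongr
        exact Real.pow_div_factorial_le_exp _ hs'.le _

lemma sum_nonempty_exp_neg_subsetEntropy_le (ι : Type*) [Fintype ι] :
    ∑ S : Finset ι with S.Nonempty, Real.exp (-subsetEntropy (Fintype.card ι) S.card) ≤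
      Fintype.card ι := by
  classical
  set n := Fintype.card ι
  have total : ∑ S : Finset ι, Real.exp (-subsetEntropy n S.card) ≤ n + 1 := by
    rw [← powerset_univ, sum_powerset_apply_card (fun s => Real.exp (-subsetEntropy n s)),
      card_univ]
    simp only [nsmul_eq_mul]
    calc _ ≤ ∑ _s ∈ range (n + 1), (1 : ℝ) := sum_le_sum fun s hs =>
          choose_mul_exp_neg_subsetEntropy_le (Nat.lt_succ_iff.1 (mem_range.1 hs))
      _ = n + 1 := by simp
  have nonempty_eq : (univ.filter fun S : Finset ι => S.Nonempty) = univ.erase ∅ := by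
    ext S
    simp [nonempty_iff_ne_empty]
  rw [nonempty_eq, sum_erase_eq_sub (mem_univ _), card_empty, subsetEntropy_zero, neg_zero,
    Real.exp_zero]
  linarith

lemma sum_nonempty_exp_neg_mul_subsetEntropy_le (ι : Type*) [Fintype ι] {r : ℝ} (hr : 1 ≤ r) :
    ∑ S : Finset ι with S.Nonempty,
      Real.exp (-((r + 1) * subsetEntropy (Fintype.card ι) S.card)) ≤ Real.exp (-r) := by
  set n := Fintype.card ι with hn
  have term (S : Finset ι) (hS : S.Nonempty) : Real.exp (-((r + 1) * subsetEntropy n S.card)) ≤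
      Real.exp (-r) / n * Real.exp (-subsetEntropy n S.card) := by
    have hn' : (0 : ℝ) < n := Nat.cast_pos.2 (hS.card_pos.trans_le (card_le_univ S))
    have log_n : 0 ≤ Real.log n := Real.log_natCast_nonneg n
    have le_entropy := one_add_log_le_subsetEntropy hS.card_pos (card_le_univ S)
    rw [← hn] at le_entropy
    calc Real.exp (-((r + 1) * subsetEntropy n S.card))
        ≤ Real.exp (-r - Real.log n + -subsetEntropy n S.card) := by
          rw [Real.exp_le_exp]
          nlinarith
      _ = _ := by rw [Real.exp_add, Real.exp_sub, Real.exp_log hn']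
  calc _ ≤ ∑ S : Finset ι with S.Nonempty,
        Real.exp (-r) / n * Real.exp (-subsetEntropy n S.card) :=
        sum_le_sum fun S hS => term S (mem_filter.1 hS).2
    _ ≤ Real.exp (-r) / n * n := by
        rw [← mul_sum]
        gcongr
        exact sum_nonempty_exp_neg_subsetEntropy_le ι
    _ = Real.exp (-r) * (n / n) := by ring
    _ ≤ Real.exp (-r) := mul_le_of_le_one_right (Real.exp_pos _).le (div_self_le_one _)

end Entropy

section DyadicLevels

/-- The pairs of dyadic exponents `k, l < N` with `2 ^ h ≤ 2 ^ (k + l)` whose ratio is smaller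
than `2 ^ h` in both directions. -/
def comparableLevels (h N : ℕ) : Finset (ℕ × ℕ) :=
  (range N ×ˢ range N).filter fun x => h ≤ x.1 + x.2 ∧ x.1 < x.2 + h ∧ x.2 < x.1 + h

lemma sum_two_pow_mul_one_add_sub_le (m : ℕ) :
    ∑ k ∈ range m, (2 : ℝ) ^ k * (1 + (m - k)) ≤ 3 * 2 ^ m := by
  have closed_form : ∑ k ∈ range m, (2 : ℝ) ^ k * (1 + (m - k)) = 3 * 2 ^ m - 3 - m := by
    induction m with
    | zero => simp
    | succ m ih =>
      have shift : ∑ k ∈ range m, (2 : ℝ) ^ k * (1 + ((m + 1 : ℕ) - k)) =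
          ∑ k ∈ range m, (2 : ℝ) ^ k * (1 + (m - k)) + ∑ k ∈ range m, (2 : ℝ) ^ k := by
        rw [← sum_add_distrib]
        exact sum_congr rfl fun k _ => by push_cast; ring
      rw [sum_range_succ, shift, ih, geom_sum_eq (by norm_num)]
      push_cast
      ring
  rw [closed_form]
  linarith [m.cast_nonneg (α := ℝ)]

lemma sum_two_pow_div_le (h l N : ℕ) :
    ∑ k ∈ range N with h ≤ k + l ∧ k < l + h, (2 : ℝ) ^ (k + l) / ((k + l - h : ℕ) + 1) ≤
      3 * 2 ^ h * (4 ^ l / (1 + l)) := by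
  have term (k : ℕ) (h₁ : h ≤ k + l) (h₂ : k < l + h) :
      (2 : ℝ) ^ (k + l) / ((k + l - h : ℕ) + 1) ≤
        2 ^ l / (1 + l) * (2 ^ k * (1 + ((l + h : ℕ) - k))) := by
    have h₁' : (h : ℝ) ≤ k + l := by exact_mod_cast h₁
    have h₂' : (k : ℝ) ≤ l + h := by exact_mod_cast h₂.le
    rw [Nat.cast_sub h₁, div_mul_eq_mul_div, div_le_div_iff₀ (by push_cast; linarith)
      (by positivity), pow_add]
    push_cast
    calc (2 : ℝ) ^ k * 2 ^ l * (1 + l) ≤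
          2 ^ k * 2 ^ l * ((1 + (l + h - k)) * (k + l - h + 1)) := by
          gcongr
          nlinarith [mul_nonneg (sub_nonneg.2 h₁') (sub_nonneg.2 h₂')]
      _ = _ := by ring
  calc _ ≤ ∑ k ∈ range N with h ≤ k + l ∧ k < l + h,
        (2 : ℝ) ^ l / (1 + l) * (2 ^ k * (1 + ((l + h : ℕ) - k))) :=
        sum_le_sum fun k hk => term k (mem_filter.1 hk).2.1 (mem_filter.1 hk).2.2
    _ ≤ ∑ k ∈ range (l + h), (2 : ℝ) ^ l / (1 + l) * (2 ^ k * (1 + ((l + h : ℕ) - k))) := by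
        refine sum_le_sum_of_subset_of_nonneg
          (fun k hk => mem_range.2 (mem_filter.1 hk).2.2) fun k hk _ => ?_
        have : (k : ℝ) ≤ (l + h : ℕ) := by exact_mod_cast (mem_range.1 hk).le
        have : (0 : ℝ) ≤ 1 + ((l + h : ℕ) - k) := by linarith
        positivity
    _ ≤ 2 ^ l / (1 + l) * (3 * 2 ^ (l + h)) := by
        rw [← mul_sum]
        gcongr
        exact sum_two_pow_mul_one_add_sub_le (l + h)
    _ = 3 * 2 ^ h * (4 ^ l / (1 + l)) := by
        rw [pow_add, show (4 : ℝ) = 2 * 2 by norm_num, mul_pow]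
        ring

lemma sum_comparableLevels_two_pow_div_mul_le (h N : ℕ) {f : ℕ → ℝ} (hf : ∀ l, 0 ≤ f l) :
    ∑ x ∈ comparableLevels h N, (2 : ℝ) ^ (x.1 + x.2) / ((x.1 + x.2 - h : ℕ) + 1) * f x.2 ≤
      3 * 2 ^ h * ∑ l ∈ range N, 4 ^ l * f l / (1 + l) := by
  calc ∑ x ∈ comparableLevels h N, (2 : ℝ) ^ (x.1 + x.2) / ((x.1 + x.2 - h : ℕ) + 1) * f x.2
      ≤ ∑ x ∈ range N ×ˢ range N with h ≤ x.1 + x.2 ∧ x.1 < x.2 + h,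
          (2 : ℝ) ^ (x.1 + x.2) / ((x.1 + x.2 - h : ℕ) + 1) * f x.2 := by
        refine sum_le_sum_of_subset_of_nonneg
          (monotone_filter_right _ fun _ _ hx => ⟨hx.1, hx.2.1⟩) fun x _ _ => ?_
        have := hf x.2
        positivity
    _ = ∑ l ∈ range N, (∑ k ∈ range N with h ≤ k + l ∧ k < l + h,
          (2 : ℝ) ^ (k + l) / ((k + l - h : ℕ) + 1)) * f l := by
        rw [sum_filter, sum_product_right]
        simp only [sum_filter, sum_mul, ite_mul, zero_mul]
    _ ≤ ∑ l ∈ range N, 3 * 2 ^ h * (4 ^ l / (1 + l)) * f l := by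
        gcongr with l
        exacts [hf l, sum_two_pow_div_le h l N]
    _ = 3 * 2 ^ h * ∑ l ∈ range N, 4 ^ l * f l / (1 + l) := by
        rw [mul_sum]
        exact sum_congr rfl fun l _ => by ring

lemma sum_comparableLevels_swap (h N : ℕ) (F : ℕ → ℕ → ℝ) :
    ∑ x ∈ comparableLevels h N, F x.1 x.2 = ∑ x ∈ comparableLevels h N, F x.2 x.1 :=
  sum_bij' (fun x _ => x.swap) (fun x _ => x.swap)
    (by simp only [comparableLevels]; grind) (by simp only [comparableLevels]; grind)
    (by simp) (by simp) (by simp)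

variable {ι : Type*} [Fintype ι]

/-- The set of indices `i` with `2 ^ k ≤ α i < 2 ^ (k + 1)`. -/
def dyadicLevel (α : ι → ℕ) (k : ℕ) : Finset ι :=
  univ.filter fun i => α i ≠ 0 ∧ Nat.log 2 (α i) = k

lemma sum_four_pow_mul_card_dyadicLevel_le (α : ι → ℕ) (N : ℕ) :
    ∑ k ∈ range N, (4 : ℝ) ^ k * (dyadicLevel α k).card ≤ ∑ i, (α i : ℝ) ^ 2 := by
  have four_pow_le {i : ι} (hi : α i ≠ 0) : (4 : ℝ) ^ Nat.log 2 (α i) ≤ (α i : ℝ) ^ 2 := by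
    have : (2 : ℝ) ^ Nat.log 2 (α i) ≤ α i := by exact_mod_cast Nat.pow_log_le_self 2 hi
    calc (4 : ℝ) ^ Nat.log 2 (α i) = (2 ^ Nat.log 2 (α i)) ^ 2 := by
          rw [← pow_mul, mul_comm, pow_mul]
          norm_num
      _ ≤ (α i : ℝ) ^ 2 := by gcongr
  calc ∑ k ∈ range N, (4 : ℝ) ^ k * (dyadicLevel α k).card
      = ∑ k ∈ range N, ∑ i with α i ≠ 0 ∧ Nat.log 2 (α i) = k, (4 : ℝ) ^ Nat.log 2 (α i) := by
        refine sum_congr rfl fun k _ => ?_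
        rw [sum_congr rfl fun i hi => by rw [(mem_filter.1 hi).2.2], sum_const, nsmul_eq_mul,
          mul_comm, dyadicLevel]
    _ ≤ ∑ i with α i ≠ 0, (4 : ℝ) ^ Nat.log 2 (α i) := by
        simp only [← filter_filter]
        exact sum_fiberwise_le_sum_of_sum_fiber_nonneg fun _ _ =>
          sum_nonneg fun _ _ => by positivity
    _ ≤ ∑ i with α i ≠ 0, (α i : ℝ) ^ 2 :=
        sum_le_sum fun i hi => four_pow_le (mem_filter.1 hi).2
    _ ≤ ∑ i, (α i : ℝ) ^ 2 :=
        sum_le_sum_of_subset_of_nonneg (filter_subset _ _) fun _ _ _ => sq_nonneg _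

end DyadicLevels

section Discrepancy

variable {ι : Type*} [Fintype ι] {A : Matrix ι ι ℝ} {ρ K R : ℝ} {α β : ι → ℕ}

/-- Edge counts between vertex sets exceed the mean they have at edge density `ρ` by no more than
the entropy of the pair of sets allows. The parameter `q` is that of the Chernoff bound; it is
chosen according to the dyadic levels on which the estimate is used. -/
def Discrepancy (ρ K : ℝ) (A : Matrix ι ι ℝ) : Prop :=
  ∀ (S T : Finset ι) (q : ℕ), (q + 1) * ∑ x ∈ S ×ˢ T, A x.1 x.2 ≤
    3 * (2 ^ q * ρ * S.card * T.card +
      K * (subsetEntropy (Fintype.card ι) S.card + subsetEntropy (Fintype.card ι) T.card))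

lemma Discrepancy.two_pow_mul_sum_dyadicLevel_le (hA : Discrepancy ρ K A) (hρ : 0 ≤ ρ) {h k l : ℕ}
    (hkl : h ≤ k + l) :
    2 ^ (k + l) * ∑ x ∈ dyadicLevel α k ×ˢ dyadicLevel β l, A x.1 x.2 ≤
      3 * ρ / 2 ^ h * ((4 ^ k * (dyadicLevel α k).card) * (4 ^ l * (dyadicLevel β l).card)) +
      3 * K * (2 ^ (k + l) / ((k + l - h : ℕ) + 1) *
        (subsetEntropy (Fintype.card ι) (dyadicLevel α k).card +
          subsetEntropy (Fintype.card ι) (dyadicLevel β l).card)) := by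
  obtain ⟨q, hq⟩ := Nat.exists_eq_add_of_le hkl
  have discrepancy := hA (dyadicLevel α k) (dyadicLevel β l) q
  rw [show k + l - h = q by omega]
  set S := dyadicLevel α k
  set T := dyadicLevel β l
  set e := subsetEntropy (Fintype.card ι) S.card + subsetEntropy (Fintype.card ι) T.card
  have four_pow : (2 : ℝ) ^ (k + l) * 2 ^ q = 4 ^ k * 4 ^ l / 2 ^ h := by
    rw [eq_div_iff (by positivity), mul_assoc, ← pow_add, add_comm q, ← hq, ← mul_pow, ← pow_add]
    norm_num
  calc 2 ^ (k + l) * ∑ x ∈ S ×ˢ T, A x.1 x.2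
      ≤ 2 ^ (k + l) * (3 * (2 ^ q * ρ * S.card * T.card + K * e) / (q + 1)) := by
        gcongr
        rwa [le_div_iff₀' (by positivity)]
    _ = 3 * ρ * (S.card * T.card) * (2 ^ (k + l) * 2 ^ q) / (q + 1) +
          3 * K * (2 ^ (k + l) / (q + 1) * e) := by ring
    _ ≤ 3 * ρ * (S.card * T.card) * (2 ^ (k + l) * 2 ^ q) +
          3 * K * (2 ^ (k + l) / (q + 1) * e) := by
        gcongr
        exact div_le_self (by positivity) (by linarith [q.cast_nonneg (α := ℝ)])
    _ = _ := by
        rw [four_pow]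
        ring

lemma Discrepancy.sum_comparableLevels_le (hA : Discrepancy ρ K A) (hρ : 0 ≤ ρ) (hK : 0 ≤ K)
    (hα : ∑ i, (α i : ℝ) ^ 2 ≤ R) (hβ : ∑ i, (β i : ℝ) ^ 2 ≤ R) (h N : ℕ) :
    ∑ x ∈ comparableLevels h N,
        2 ^ (x.1 + x.2) * ∑ y ∈ dyadicLevel α x.1 ×ˢ dyadicLevel β x.2, A y.1 y.2 ≤
      3 * ρ / 2 ^ h * R ^ 2 + 18 * K * 2 ^ h * (3 * R + 2 * Fintype.card ι) := by
  set n := Fintype.card ι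
  set e : (ι → ℕ) → ℕ → ℝ := fun γ k => subsetEntropy n (dyadicLevel γ k).card
  set w : ℕ → ℕ → ℝ := fun k l => 2 ^ (k + l) / ((k + l - h : ℕ) + 1)
  have entropy {γ : ι → ℕ} (hγ : ∑ i, (γ i : ℝ) ^ 2 ≤ R) :
      ∑ x ∈ comparableLevels h N, w x.1 x.2 * e γ x.2 ≤ 3 * 2 ^ h * (3 * R + 2 * n) := by
    refine (sum_comparableLevels_two_pow_div_mul_le h N (f := e γ)
      fun l => subsetEntropy_nonneg (card_le_univ _)).trans ?_
    gcongr
    refine (sum_four_pow_mul_subsetEntropy_div_le (fun l => card_le_univ _) N).trans ?_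
    gcongr
    exact (sum_four_pow_mul_card_dyadicLevel_le γ N).trans hγ
  have density : ∑ x ∈ comparableLevels h N,
      ((4 : ℝ) ^ x.1 * (dyadicLevel α x.1).card) * (4 ^ x.2 * (dyadicLevel β x.2).card) ≤
        R * R := by
    refine (sum_le_sum_of_subset_of_nonneg (filter_subset _ _)
      fun _ _ _ => by positivity).trans ?_
    rw [sum_product' (f := fun k l => ((4 : ℝ) ^ k * (dyadicLevel α k).card) *
      (4 ^ l * (dyadicLevel β l).card)), ← sum_mul_sum]
    have hR : 0 ≤ R := (sum_nonneg fun i _ => sq_nonneg _).trans hα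
    exact mul_le_mul ((sum_four_pow_mul_card_dyadicLevel_le α N).trans hα)
      ((sum_four_pow_mul_card_dyadicLevel_le β N).trans hβ)
      (sum_nonneg fun _ _ => by positivity) hR
  have entropy_swap : ∑ x ∈ comparableLevels h N, w x.1 x.2 * e α x.1 ≤
      3 * 2 ^ h * (3 * R + 2 * n) := by
    rw [sum_comparableLevels_swap h N fun k l => w k l * e α k]
    have w_comm (k l : ℕ) : w k l = w l k := by simp only [w, add_comm k l]
    exact (sum_congr rfl fun x _ => by rw [w_comm]).trans_le (entropy hα)
  calc _ ≤ ∑ x ∈ comparableLevels h N, (3 * ρ / 2 ^ h *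
          ((4 ^ x.1 * (dyadicLevel α x.1).card) * (4 ^ x.2 * (dyadicLevel β x.2).card)) +
          3 * K * (w x.1 x.2 * (e α x.1 + e β x.2))) :=
        sum_le_sum fun x hx => hA.two_pow_mul_sum_dyadicLevel_le hρ (mem_filter.1 hx).2.1
    _ ≤ 3 * ρ / 2 ^ h * (R * R) +
          3 * K * (3 * 2 ^ h * (3 * R + 2 * n) + 3 * 2 ^ h * (3 * R + 2 * n)) := by
        simp only [sum_add_distrib, ← mul_sum, mul_add (w _ _)]
        gcongr
        exact entropy hβ
    _ = 3 * ρ / 2 ^ h * R ^ 2 + 18 * K * 2 ^ h * (3 * R + 2 * n) := by ring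

/-- The index pairs on which the product of the two vectors exceeds the threshold separating
light from heavy couples. -/
def heavyPairs (h : ℕ) (α β : ι → ℕ) : Finset (ι × ι) :=
  univ.filter fun x => 4 * 2 ^ h < α x.1 * β x.2

lemma le_or_le_or_comparable_of_lt_mul {h a b : ℕ} (hab : 4 * 2 ^ h < a * b) :
    2 ^ h * b ≤ 2 * a ∨ 2 ^ h * a ≤ 2 * b ∨
      (h ≤ Nat.log 2 a + Nat.log 2 b ∧ Nat.log 2 a < Nat.log 2 b + h ∧
        Nat.log 2 b < Nat.log 2 a + h) := by
  have ha : a ≠ 0 := by rintro rfl; simp at hab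
  have hb : b ≠ 0 := by rintro rfl; simp at hab
  have mul_le {a b : ℕ} (ha : a ≠ 0) (hlog : Nat.log 2 b + h ≤ Nat.log 2 a) :
      2 ^ h * b ≤ 2 * a := calc
    2 ^ h * b ≤ 2 ^ h * 2 ^ (Nat.log 2 b + 1) := by
      gcongr
      exact (Nat.lt_pow_succ_log_self one_lt_two b).le
    _ = 2 * 2 ^ (Nat.log 2 b + h) := by ring
    _ ≤ 2 * 2 ^ Nat.log 2 a := by gcongr; norm_num
    _ ≤ 2 * a := by
      gcongr
      exact Nat.pow_log_le_self 2 ha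
  by_cases hl : Nat.log 2 b + h ≤ Nat.log 2 a
  · exact .inl (mul_le ha hl)
  by_cases hr : Nat.log 2 a + h ≤ Nat.log 2 b
  · exact .inr (.inl (mul_le hb hr))
  refine .inr (.inr ⟨?_, not_le.1 hl, not_le.1 hr⟩)
  have : 2 ^ (h + 2) < 2 ^ (Nat.log 2 a + 1 + (Nat.log 2 b + 1)) := calc
    2 ^ (h + 2) = 4 * 2 ^ h := by ring
    _ < a * b := hab
    _ ≤ 2 ^ (Nat.log 2 a + 1) * 2 ^ (Nat.log 2 b + 1) := by
      gcongr <;> exact (Nat.lt_pow_succ_log_self one_lt_two _).le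
    _ = _ := (pow_add ..).symm
  have := (Nat.pow_lt_pow_iff_right one_lt_two).1 this
  omega

/-- The heavy pairs whose two values lie on comparable dyadic levels. -/
def comparablePairs (h : ℕ) (α β : ι → ℕ) : Finset (ι × ι) :=
  (heavyPairs h α β).filter fun x => h ≤ Nat.log 2 (α x.1) + Nat.log 2 (β x.2) ∧
    Nat.log 2 (α x.1) < Nat.log 2 (β x.2) + h ∧ Nat.log 2 (β x.2) < Nat.log 2 (α x.1) + h

lemma sum_heavyPairs_sdiff_comparablePairs_le [DecidableEq ι] (hA : ∀ i j, 0 ≤ A i j) {E : ℝ}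
    (hα : ∑ x : ι × ι, (α x.1 : ℝ) ^ 2 * A x.1 x.2 ≤ E)
    (hβ : ∑ x : ι × ι, (β x.2 : ℝ) ^ 2 * A x.1 x.2 ≤ E) (h : ℕ) :
    ∑ x ∈ heavyPairs h α β \ comparablePairs h α β, (α x.1 * β x.2 : ℝ) * A x.1 x.2 ≤
      4 * E / 2 ^ h := by
  have term (x : ι × ι) (hx : x ∈ heavyPairs h α β \ comparablePairs h α β) :
      (α x.1 * β x.2 : ℝ) * A x.1 x.2 ≤
        2 / 2 ^ h * ((α x.1 : ℝ) ^ 2 * A x.1 x.2 + (β x.2 : ℝ) ^ 2 * A x.1 x.2) := by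
    have product_le : 2 ^ h * (α x.1 * β x.2) ≤ 2 * (α x.1 ^ 2 + β x.2 ^ 2) := by
      simp only [comparablePairs, heavyPairs, mem_sdiff, mem_filter, mem_univ, true_and,
        not_and] at hx
      obtain hl | hr | hc := le_or_le_or_comparable_of_lt_mul hx.1
      · nlinarith
      · nlinarith
      · exact absurd hc.2.2 (hx.2 hx.1 hc.1 hc.2.1)
    have product_le' : (2 : ℝ) ^ h * (α x.1 * β x.2) ≤ 2 * (α x.1 ^ 2 + β x.2 ^ 2) := by
      exact_mod_cast product_le
    rw [← add_mul, ← mul_assoc, div_mul_eq_mul_div]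
    gcongr
    · exact hA _ _
    · rwa [le_div_iff₀' (by positivity)]
  calc _ ≤ ∑ x : ι × ι, 2 / 2 ^ h * ((α x.1 : ℝ) ^ 2 * A x.1 x.2 + (β x.2 : ℝ) ^ 2 * A x.1 x.2) :=
        (sum_le_sum term).trans <| sum_le_sum_of_subset_of_nonneg (subset_univ _) fun x _ _ => by
          have := hA x.1 x.2
          positivity
    _ ≤ 2 / 2 ^ h * (E + E) := by
        rw [← mul_sum, sum_add_distrib]
        gcongr
    _ = 4 * E / 2 ^ h := by ring

lemma sum_comparablePairs_le (hA : ∀ i j, 0 ≤ A i j) (h : ℕ) (α β : ι → ℕ) :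
    ∃ N, ∑ x ∈ comparablePairs h α β, (α x.1 * β x.2 : ℝ) * A x.1 x.2 ≤
      4 * ∑ x ∈ comparableLevels h N,
        2 ^ (x.1 + x.2) * ∑ y ∈ dyadicLevel α x.1 ×ˢ dyadicLevel β x.2, A y.1 y.2 := by
  have lt_two_pow {a : ℕ} : (a : ℝ) ≤ 2 ^ (Nat.log 2 a + 1) := by
    exact_mod_cast (Nat.lt_pow_succ_log_self one_lt_two a).le
  refine ⟨univ.sup (fun i => Nat.log 2 (α i)) + univ.sup (fun i => Nat.log 2 (β i)) + 1, ?_⟩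
  set N := univ.sup (fun i => Nat.log 2 (α i)) + univ.sup (fun i => Nat.log 2 (β i)) + 1
  have hαN i : Nat.log 2 (α i) < N := by
    have := le_sup (f := fun i => Nat.log 2 (α i)) (mem_univ i)
    omega
  have hβN i : Nat.log 2 (β i) < N := by
    have := le_sup (f := fun i => Nat.log 2 (β i)) (mem_univ i)
    omega
  have maps_to : ∀ x ∈ comparablePairs h α β,
      (Nat.log 2 (α x.1), Nat.log 2 (β x.2)) ∈ comparableLevels h N := fun x hx =>
    mem_filter.2 ⟨mem_product.2 ⟨mem_range.2 (hαN _), mem_range.2 (hβN _)⟩, (mem_filter.1 hx).2⟩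
  rw [← sum_fiberwise_of_maps_to maps_to, mul_sum]
  refine sum_le_sum fun y _ => ?_
  rw [← mul_assoc, mul_sum]
  refine (sum_le_sum fun x hx => ?_).trans
    (sum_le_sum_of_subset_of_nonneg (fun x hx => ?_) fun x _ _ => ?_)
  · obtain rfl := (mem_filter.1 hx).2
    refine mul_le_mul_of_nonneg_right ?_ (hA _ _)
    calc (α x.1 * β x.2 : ℝ) ≤ 2 ^ (Nat.log 2 (α x.1) + 1) * 2 ^ (Nat.log 2 (β x.2) + 1) := by
          gcongr <;> exact lt_two_pow
      _ = 4 * 2 ^ (Nat.log 2 (α x.1) + Nat.log 2 (β x.2)) := by ring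
  · simp only [comparablePairs, heavyPairs, mem_filter, mem_univ, true_and] at hx
    obtain ⟨⟨hx, -⟩, rfl⟩ := hx
    simp only [mem_product, dyadicLevel, mem_filter, mem_univ, true_and, and_true]
    constructor <;> intro h0 <;> simp [h0] at hx
  · have := hA x.1 x.2
    positivity

lemma Discrepancy.sum_heavyPairs_le (hA : Discrepancy ρ K A) (hA₀ : ∀ i j, 0 ≤ A i j)
    (hρ : 0 ≤ ρ) (hK : 0 ≤ K) (hα : ∑ i, (α i : ℝ) ^ 2 ≤ R) (hβ : ∑ i, (β i : ℝ) ^ 2 ≤ R) {E : ℝ}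
    (hαE : ∑ x : ι × ι, (α x.1 : ℝ) ^ 2 * A x.1 x.2 ≤ E)
    (hβE : ∑ x : ι × ι, (β x.2 : ℝ) ^ 2 * A x.1 x.2 ≤ E) (h : ℕ) :
    ∑ x ∈ heavyPairs h α β, (α x.1 * β x.2 : ℝ) * A x.1 x.2 ≤
      4 * E / 2 ^ h +
        4 * (3 * ρ / 2 ^ h * R ^ 2 + 18 * K * 2 ^ h * (3 * R + 2 * Fintype.card ι)) := by
  classical
  obtain ⟨N, hN⟩ := sum_comparablePairs_le hA₀ h α β
  rw [← sum_sdiff (filter_subset _ _ : comparablePairs h α β ⊆ heavyPairs h α β)]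
  refine add_le_add (sum_heavyPairs_sdiff_comparablePairs_le hA₀ hαE hβE h) (hN.trans ?_)
  gcongr
  exact hA.sum_comparableLevels_le hρ hK hα hβ h N

end Discrepancy

section BernoulliSums

variable {Ω : Type*} [MeasurableSpace Ω] {μ : Measure Ω} [IsProbabilityMeasure μ] {X : Ω → ℝ}

lemma integrable_of_binary (hX : Measurable X) (h01 : ∀ ω, X ω = 0 ∨ X ω = 1) : Integrable X μ :=
  .of_bound hX.aestronglyMeasurable 1 (.of_forall fun ω => by
    obtain h | h := h01 ω <;> simp [h])

lemma mgf_le_of_binary (hX : Measurable X) (h01 : ∀ ω, X ω = 0 ∨ X ω = 1) (t : ℝ) :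
    mgf X μ t ≤ Real.exp ((∫ ω, X ω ∂μ) * (Real.exp t - 1)) := by
  have exp_eq : (fun ω => Real.exp (t * X ω)) = fun ω => 1 + X ω * (Real.exp t - 1) := by
    funext ω
    obtain h | h := h01 ω <;> simp [h]
  rw [mgf, exp_eq, integral_add (integrable_const 1) ((integrable_of_binary hX h01).mul_const _),
    integral_mul_const, integral_const, probReal_univ, one_smul, add_comm]
  exact Real.add_one_le_exp _

lemma measureReal_le_sum_mul_le_of_binary {κ : Type*} [Fintype κ] {X : κ → Ω → ℝ}
    (hX : ∀ e, Measurable (X e)) (h01 : ∀ e ω, X e ω = 0 ∨ X e ω = 1) (hind : iIndepFun X μ)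
    (w : κ → ℝ) (t : ℝ) :
    μ.real {ω | t ≤ ∑ e, w e * X e ω} ≤
      Real.exp (∑ e, (∫ ω, X e ω ∂μ) * (Real.exp (w e) - 1) - t) := by
  set Y : κ → Ω → ℝ := fun e ω => w e * X e ω with hY
  have hYm e : Measurable (Y e) := (hX e).const_mul _
  have hYind : iIndepFun Y μ := hind.comp (fun e x => w e * x) fun e => measurable_const_mul (w e)
  have integrable_exp (e : κ) : Integrable (fun ω => Real.exp (1 * Y e ω)) μ := by
    refine integrable_exp_mul_of_mem_Icc (a := -|w e|) (b := |w e|) (hYm e).aemeasurable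
      (.of_forall fun ω => abs_le.1 ?_)
    obtain h | h := h01 e ω <;> simp [hY, h]
  have markov := measure_ge_le_exp_mul_mgf t zero_le_one
    (hYind.integrable_exp_mul_sum hYm (s := univ) fun e _ => integrable_exp e)
  simp only [Finset.sum_apply] at markov
  calc _ ≤ Real.exp (-1 * t) * mgf (∑ e, Y e) μ 1 := markov
    _ = Real.exp (-1 * t) * ∏ e, mgf (X e) μ (w e) := by
        rw [hYind.mgf_sum hYm]
        congr 1
        refine prod_congr rfl fun e _ => ?_
        rw [hY, mgf_const_mul, mul_one]
    _ ≤ Real.exp (-1 * t) * ∏ e, Real.exp ((∫ ω, X e ω ∂μ) * (Real.exp (w e) - 1)) := by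
        gcongr with e
        exacts [fun _ _ => mgf_nonneg, mgf_le_of_binary (hX e) (h01 e) _]
    _ = _ := by
        rw [← Real.exp_sum, ← Real.exp_add]
        congr 1
        ring

/-- The events `f q < X` form a chain, so no union bound is needed. -/
lemma measureReal_exists_lt_le {κ : Type*} [Countable κ] {f : κ → ℝ} {ε : ℝ}
    (hε : 0 ≤ ε) (h : ∀ q, μ.real {ω | f q < X ω} ≤ ε) : μ.real {ω | ∃ q, f q < X ω} ≤ ε := by
  have directed : Directed (· ⊆ ·) fun q => {ω | f q < X ω} := fun q q' => by
    obtain hq | hq := le_total (f q) (f q')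
    · exact ⟨q, subset_rfl, fun ω (hω : f q' < X ω) => hq.trans_lt hω⟩
    · exact ⟨q', fun ω (hω : f q < X ω) => hq.trans_lt hω, subset_rfl⟩
  refine ENNReal.toReal_le_of_le_ofReal hε ?_
  rw [Set.ofPred_exists, directed.measure_iUnion]
  exact iSup_le fun q => (ENNReal.le_ofReal_iff_toReal_le (measure_ne_top _ _) hε).2 (h q)

end BernoulliSums

lemma sum_eq_sum_upperTriangle {ι M : Type*} [Fintype ι] [LinearOrder ι] [AddCommMonoid M]
    (f : ι × ι → M) :
    ∑ x, f x = ∑ e : {e : ι × ι // e.1 ≤ e.2},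
      (f e + if e.1.1 < e.1.2 then f e.1.swap else 0) := by
  rw [← sum_filter_add_sum_filter_not univ (fun x : ι × ι => x.1 ≤ x.2), sum_add_distrib]
  congr 1
  · exact sum_subtype _ (by simp) f
  · rw [← sum_subtype (univ.filter fun x : ι × ι => x.1 ≤ x.2) (by simp)
      (fun x => if x.1 < x.2 then f x.swap else 0), ← sum_filter, filter_filter]
    exact sum_nbij' Prod.swap Prod.swap (by simp +contextual [le_of_lt]) (by simp +contextual)
      (by simp) (by simp) (by simp)

/-- This separates the two occurrences of an off-diagonal entry of a symmetric matrix. -/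
lemma exp_add_sub_one_sub_le (u v : ℝ) :
    Real.exp (u + v) - 1 - (u + v) ≤
      (Real.exp (2 * u) - 1 - 2 * u) / 2 + (Real.exp (2 * v) - 1 - 2 * v) / 2 := by
  rw [Real.exp_add, two_mul, two_mul, Real.exp_add, Real.exp_add]
  linarith [two_mul_le_add_sq (Real.exp u) (Real.exp v), sq (Real.exp u), sq (Real.exp v)]

namespace IsInhomogeneousER

variable {Ω : Type*} [MeasurableSpace Ω] {μ : Measure Ω} {n : ℕ}
  {p : Matrix (Fin n) (Fin n) ℝ} {A : Ω → Matrix (Fin n) (Fin n) ℝ}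

lemma entry_nonneg (hA : IsInhomogeneousER μ p A) (ω : Ω) (i j : Fin n) : 0 ≤ A ω i j := by
  obtain h | h := hA.binary ω i j <;> simp [h]

lemma prob_nonneg (hA : IsInhomogeneousER μ p A) (i j : Fin n) : 0 ≤ p i j :=
  hA.prob i j ▸ measureReal_nonneg

lemma prob_symm (hA : IsInhomogeneousER μ p A) : p.IsSymm := by
  ext i j
  rw [Matrix.transpose_apply, ← hA.prob i j, ← hA.prob j i]
  simp only [(hA.symm _).apply i j]

lemma integral_entry (hA : IsInhomogeneousER μ p A) (i j : Fin n) :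
    ∫ ω, A ω i j ∂μ = p i j := by
  have indicator_eq : (fun ω => A ω i j) = Set.indicator {ω | A ω i j = 1} 1 := by
    funext ω
    obtain h | h := hA.binary ω i j <;> simp [Set.indicator, h]
  have measurableSet : MeasurableSet {ω | A ω i j = 1} :=
    hA.measurable i j (measurableSet_singleton 1)
  rw [indicator_eq, integral_indicator_one measurableSet, hA.prob i j]

variable [IsProbabilityMeasure μ]

lemma expectation_regularize (hA : IsInhomogeneousER μ p A) (τ : ℝ) :
    (expectation μ fun ω => regularize τ (A ω)) = regularize τ p := by
  ext i j
  simp only [expectation, Matrix.of_apply, regularize_apply]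
  rw [integral_add (integrable_of_binary (hA.measurable i j) fun ω => hA.binary ω i j)
    (integrable_const _), hA.integral_entry, integral_const, probReal_univ, one_smul]

lemma measureReal_le_sum_mul_sub_le (hA : IsInhomogeneousER μ p A) (c : Fin n × Fin n → ℝ)
    (t : ℝ) :
    μ.real {ω | t ≤ ∑ x, c x * (A ω x.1 x.2 - p x.1 x.2)} ≤
      Real.exp (∑ x, p x.1 x.2 * ((Real.exp (2 * c x) - 1 - 2 * c x) / 2) - t) := by
  set v : {e : Fin n × Fin n // e.1 ≤ e.2} → ℝ :=
    fun e => if e.1.1 < e.1.2 then c e.1.swap else 0 with hv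
  have centered_eq (ω : Ω) : ∑ x, c x * (A ω x.1 x.2 - p x.1 x.2) =
      ∑ e : {e : Fin n × Fin n // e.1 ≤ e.2}, (c e + v e) * A ω e.1.1 e.1.2 -
        ∑ e : {e : Fin n × Fin n // e.1 ≤ e.2}, (c e + v e) * p e.1.1 e.1.2 := by
    rw [sum_eq_sum_upperTriangle, ← sum_sub_distrib]
    refine sum_congr rfl fun e _ => ?_
    simp only [hv, Prod.fst_swap, Prod.snd_swap, (hA.symm ω).apply e.1.1 e.1.2,
      hA.prob_symm.apply e.1.1 e.1.2]
    split_ifs <;> ring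
  have exponent_le : ∑ e : {e : Fin n × Fin n // e.1 ≤ e.2},
      p e.1.1 e.1.2 * (Real.exp (c e + v e) - 1 - (c e + v e)) ≤
        ∑ x, p x.1 x.2 * ((Real.exp (2 * c x) - 1 - 2 * c x) / 2) := by
    rw [sum_eq_sum_upperTriangle]
    refine sum_le_sum fun e _ => (mul_le_mul_of_nonneg_left (exp_add_sub_one_sub_le _ _)
      (hA.prob_nonneg _ _)).trans_eq ?_
    simp only [hv, Prod.fst_swap, Prod.snd_swap, hA.prob_symm.apply e.1.1 e.1.2]
    split_ifs <;> simp [mul_add]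
  have tail := measureReal_le_sum_mul_le_of_binary (fun _ => hA.measurable _ _)
    (fun _ ω => hA.binary ω _ _) hA.indep (fun e => c e + v e)
    (t + ∑ e : {e : Fin n × Fin n // e.1 ≤ e.2}, (c e + v e) * p e.1.1 e.1.2)
  simp only [hA.integral_entry] at tail
  simp only [centered_eq, le_sub_iff_add_le]
  refine tail.trans (Real.exp_le_exp.2 ?_)
  rw [add_comm t, ← sub_sub, ← sum_sub_distrib]
  refine sub_le_sub_right (le_trans (le_of_eq ?_) exponent_le) t
  exact sum_congr rfl fun e _ => by ring

lemma chernoff (hA : IsInhomogeneousER μ p A) (P : Finset (Fin n × Fin n))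
    (c : Fin n × Fin n → ℝ) (t : ℝ) :
    μ.real {ω | t ≤ ∑ x ∈ P, c x * (A ω x.1 x.2 - p x.1 x.2)} ≤
      Real.exp (∑ x ∈ P, p x.1 x.2 * ((Real.exp (2 * c x) - 1 - 2 * c x) / 2) - t) := by
  have := hA.measureReal_le_sum_mul_sub_le (fun x => if x ∈ P then c x else 0) t
  simp only [ite_mul, zero_mul, sum_ite_mem, univ_inter] at this
  refine this.trans_eq ?_
  congr 2
  rw [← sum_subset (subset_univ P) fun x _ hx => by simp [hx]]
  exact sum_congr rfl fun x hx => by simp [hx]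

end IsInhomogeneousER

lemma exp_neg_le_half {x : ℝ} (hx : 1 ≤ x) : Real.exp (-x) ≤ 1 / 2 := by
  rw [Real.exp_neg, one_div]
  exact inv_anti₀ two_pos (by linarith [Real.add_one_le_exp x])

lemma natAbs_le_sq (k : ℤ) : (k.natAbs : ℝ) ≤ (k : ℝ) ^ 2 := by
  rw [← Int.cast_natCast, ← Int.cast_pow, Int.cast_le]
  exact Int.natAbs_le_self_sq k

section LatticeBall

variable {ι : Type*} [Fintype ι] [DecidableEq ι] {R : ℝ}

/-- The integer points of the closed Euclidean ball of squared radius `R`. -/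
noncomputable def latticeBall (ι : Type*) [Fintype ι] [DecidableEq ι] (R : ℝ) : Finset (ι → ℤ) :=
  (Fintype.piFinset fun _ => Icc (-(⌊R⌋₊ : ℤ)) ⌊R⌋₊).filter fun a => ∑ i, (a i : ℝ) ^ 2 ≤ R

lemma mem_latticeBall {a : ι → ℤ} : a ∈ latticeBall ι R ↔ ∑ i, (a i : ℝ) ^ 2 ≤ R := by
  simp only [latticeBall, mem_filter, Fintype.mem_piFinset, mem_Icc, and_iff_right_iff_imp]
  intro h i
  rw [← abs_le, Int.abs_eq_natAbs, Nat.cast_le]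
  refine Nat.le_floor ?_
  calc ((a i).natAbs : ℝ) ≤ (a i : ℝ) ^ 2 := natAbs_le_sq _
    _ ≤ ∑ i, (a i : ℝ) ^ 2 := single_le_sum (fun i _ => sq_nonneg (a i : ℝ)) (mem_univ i)
    _ ≤ R := h

lemma sum_Icc_half_pow_natAbs_le (m : ℕ) :
    ∑ k ∈ Icc (-(m : ℤ)) m, (1 / 2 : ℝ) ^ k.natAbs ≤ 3 := by
  have closed_form : ∑ k ∈ Icc (-(m : ℤ)) m, (1 / 2 : ℝ) ^ k.natAbs = 3 - 2 * (1 / 2) ^ m := by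
    induction m with
    | zero => norm_num
    | succ m ih =>
      have Icc_succ : Icc (-((m + 1 : ℕ) : ℤ)) ((m + 1 : ℕ) : ℤ) =
          insert (-((m + 1 : ℕ) : ℤ)) (insert ((m + 1 : ℕ) : ℤ) (Icc (-(m : ℤ)) m)) := by
        ext k
        simp only [mem_insert, mem_Icc]
        omega
      rw [Icc_succ, sum_insert (by simp only [mem_insert, mem_Icc]; omega),
        sum_insert (by simp only [mem_Icc]; omega), ih, Int.natAbs_neg, Int.natAbs_natCast,
        pow_succ]
      ring
  rw [closed_form]
  linarith [show (0 : ℝ) ≤ 2 * (1 / 2) ^ m by positivity]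

/-- On the ball `∑ i, |a i| ≤ R`, so that its points have weight at least `exp (-R)` under the
product of the weights `2 ^ (-|a i|)`. -/
lemma card_latticeBall_le (R : ℝ) :
    ((latticeBall ι R).card : ℝ) ≤ Real.exp (R + 2 * Fintype.card ι) := by
  have one_le (a : ι → ℤ) (ha : a ∈ latticeBall ι R) :
      1 ≤ Real.exp R * ∏ i, (1 / 2 : ℝ) ^ (a i).natAbs := by
    have sum_natAbs_le : ∑ i, ((a i).natAbs : ℝ) ≤ R :=
      (sum_le_sum fun i _ => natAbs_le_sq (a i)).trans (mem_latticeBall.1 ha)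
    calc 1 = Real.exp R * Real.exp (-R) := by rw [← Real.exp_add, add_neg_cancel, Real.exp_zero]
      _ ≤ Real.exp R * Real.exp (∑ i, -((a i).natAbs : ℝ)) := by
          gcongr
          rwa [sum_neg_distrib, neg_le_neg_iff]
      _ = Real.exp R * ∏ i, Real.exp (-1) ^ (a i).natAbs := by
          simp only [Real.exp_sum, ← Real.exp_nat_mul, mul_neg_one]
      _ ≤ Real.exp R * ∏ i, (1 / 2 : ℝ) ^ (a i).natAbs := by
          gcongr
          exact exp_neg_le_half le_rfl
  have three_le : (3 : ℝ) ≤ Real.exp 2 := by linarith [Real.add_one_le_exp 2]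
  calc ((latticeBall ι R).card : ℝ) = ∑ _a ∈ latticeBall ι R, (1 : ℝ) := by simp
    _ ≤ ∑ a ∈ latticeBall ι R, Real.exp R * ∏ i, (1 / 2 : ℝ) ^ (a i).natAbs := sum_le_sum one_le
    _ ≤ ∑ a ∈ Fintype.piFinset fun _ : ι => Icc (-(⌊R⌋₊ : ℤ)) ⌊R⌋₊,
          Real.exp R * ∏ i, (1 / 2 : ℝ) ^ (a i).natAbs :=
        sum_le_sum_of_subset_of_nonneg (filter_subset _ _) fun _ _ _ => by positivity
    _ = Real.exp R * ∏ _i : ι, ∑ k ∈ Icc (-(⌊R⌋₊ : ℤ)) ⌊R⌋₊, (1 / 2 : ℝ) ^ k.natAbs := by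
        rw [← mul_sum, prod_univ_sum]
    _ ≤ Real.exp R * ∏ _i : ι, Real.exp 2 := by
        gcongr
        exact (sum_Icc_half_pow_natAbs_le _).trans three_le
    _ = Real.exp (R + 2 * Fintype.card ι) := by
        rw [prod_const, card_univ, ← Real.exp_nat_mul, ← Real.exp_add, mul_comm 2]

/-- The contribution of the light couples, the complement of `heavyPairs`, to the bilinear form of
`B` is at most `X` at all lattice points of the ball of squared radius `R`. -/
def LightBound (h : ℕ) (R X : ℝ) (B : Matrix ι ι ℝ) : Prop :=
  ∀ a b : ι → ℤ, ∑ i, (a i : ℝ) ^ 2 ≤ R → ∑ i, (b i : ℝ) ^ 2 ≤ R →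
    ∑ x ∈ (heavyPairs h (fun i => (a i).natAbs) fun i => (b i).natAbs)ᶜ,
      (a x.1 * b x.2 : ℝ) * B x.1 x.2 ≤ X

end LatticeBall

lemma Discrepancy.of_nonempty {ι : Type*} [Fintype ι] {ρ K : ℝ} {A : Matrix ι ι ℝ} (hK : 0 ≤ K)
    (h : ∀ S T : Finset ι, S.Nonempty → T.Nonempty → ∀ q : ℕ,
      (q + 1) * ∑ x ∈ S ×ˢ T, A x.1 x.2 ≤ 3 * (2 ^ q * ρ * S.card * T.card +
        K * (subsetEntropy (Fintype.card ι) S.card + subsetEntropy (Fintype.card ι) T.card))) :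
    Discrepancy ρ K A := by
  intro S T q
  have hS := subsetEntropy_nonneg (card_le_univ S)
  have hT := subsetEntropy_nonneg (card_le_univ T)
  obtain hS₀ | hS₀ := S.eq_empty_or_nonempty
  · rw [hS₀, empty_product, sum_empty, card_empty, ← card_empty (α := ι), ← hS₀, hS₀]
    simp only [card_empty, Nat.cast_zero, mul_zero, zero_mul, zero_add, subsetEntropy_zero]
    positivity
  obtain hT₀ | hT₀ := T.eq_empty_or_nonempty
  · rw [hT₀, product_empty, sum_empty]
    simp only [card_empty, Nat.cast_zero, mul_zero, zero_add, add_zero, subsetEntropy_zero]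
    positivity
  exact h S T hS₀ hT₀ q

namespace IsInhomogeneousER

variable {Ω : Type*} [MeasurableSpace Ω] {μ : Measure Ω} [IsProbabilityMeasure μ] {n : ℕ}
  {p : Matrix (Fin n) (Fin n) ℝ} {A : Ω → Matrix (Fin n) (Fin n) ℝ} {ρ r : ℝ}

lemma measureReal_lt_sum_product_le (hA : IsInhomogeneousER μ p A) (hp : ∀ i j, p i j ≤ ρ)
    (S T : Finset (Fin n)) {E : ℝ} (hE : 0 ≤ E) (q : ℕ) :
    μ.real {ω | 3 * (2 ^ q * ρ * S.card * T.card + E) / (q + 1) <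
      ∑ x ∈ S ×ˢ T, A ω x.1 x.2} ≤ Real.exp (-E) := by
  set c : ℝ := (q + 1) * Real.log 2 / 2 with hc
  have hlog : 2 / 3 < Real.log 2 := by linarith [Real.log_two_gt_d9]
  have hc0 : 0 < c := by positivity
  set P := ∑ x ∈ S ×ˢ T, p x.1 x.2 with hP
  set m := ρ * (S.card * T.card) with hm
  have hP0 : 0 ≤ P := sum_nonneg fun x _ => hA.prob_nonneg _ _
  have hPm : P ≤ m := by
    have := sum_le_card_nsmul (S ×ˢ T) (fun x => p x.1 x.2) ρ fun x _ => hp _ _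
    rw [card_product, nsmul_eq_mul, Nat.cast_mul] at this
    linarith
  have exp_two_mul : Real.exp (2 * c) = 2 ^ q * 2 := by
    rw [hc, ← pow_succ, mul_div_cancel₀ _ two_ne_zero, ← Real.exp_log two_pos, ← Real.exp_nat_mul,
      Real.exp_log two_pos]
    push_cast
    rfl
  have centered (ω : Ω) (hω : 3 * (2 ^ q * ρ * S.card * T.card + E) / (q + 1) <
      ∑ x ∈ S ×ˢ T, A ω x.1 x.2) : 3 * Real.log 2 / 2 * (2 ^ q * m + E) - c * P ≤
        ∑ x ∈ S ×ˢ T, c * (A ω x.1 x.2 - p x.1 x.2) := by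
    rw [← mul_sum, sum_sub_distrib, mul_sub]
    refine sub_le_sub_right ?_ _
    calc 3 * Real.log 2 / 2 * (2 ^ q * m + E)
        = c * (3 * (2 ^ q * ρ * S.card * T.card + E) / (q + 1)) := by
          rw [hc, hm]
          field_simp
      _ ≤ _ := mul_le_mul_of_nonneg_left hω.le hc0.le
  refine (measureReal_mono centered).trans ((hA.chernoff _ _ _).trans (Real.exp_le_exp.2 ?_))
  rw [← sum_mul, ← hP, exp_two_mul]
  have h2q : 0 ≤ (2 : ℝ) ^ q * m := mul_nonneg (by positivity) (hP0.trans hPm)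
  calc P * ((2 ^ q * 2 - 1 - 2 * c) / 2) - (3 * Real.log 2 / 2 * (2 ^ q * m + E) - c * P)
      = 2 ^ q * P - P / 2 - 3 * Real.log 2 / 2 * (2 ^ q * m + E) := by ring
    _ ≤ 2 ^ q * m - 1 * (2 ^ q * m + E) := by
        gcongr ?_ - ?_ * _
        · exact (sub_le_self _ (by positivity)).trans (by gcongr)
        · linarith
    _ = -E := by ring

lemma measureReal_not_discrepancy_le (hA : IsInhomogeneousER μ p A) (hp : ∀ i j, p i j ≤ ρ)
    (hr : 1 ≤ r) : μ.real {ω | ¬ Discrepancy ρ (r + 1) (A ω)} ≤ Real.exp (-r) / 2 := by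
  set e : Finset (Fin n) → ℝ := fun S => subsetEntropy (Fintype.card (Fin n)) S.card with he
  have he0 (S : Finset (Fin n)) : 0 ≤ e S := subsetEntropy_nonneg (card_le_univ S)
  set bad : Finset (Fin n) × Finset (Fin n) → Set Ω := fun x => {ω | ∃ q : ℕ,
    3 * (2 ^ q * ρ * x.1.card * x.2.card + (r + 1) * (e x.1 + e x.2)) / (q + 1) <
      ∑ y ∈ x.1 ×ˢ x.2, A ω y.1 y.2} with hbad
  set 𝒮 : Finset (Finset (Fin n)) := univ.filter fun S => S.Nonempty with h𝒮
  have subset_iUnion : {ω | ¬ Discrepancy ρ (r + 1) (A ω)} ⊆ ⋃ x ∈ 𝒮 ×ˢ 𝒮, bad x := by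
    intro ω hω
    replace hω := mt (Discrepancy.of_nonempty (by linarith)) hω
    simp only [not_forall, not_le] at hω
    obtain ⟨S, T, hS, hT, q, hq⟩ := hω
    simp only [Set.mem_iUnion]
    exact ⟨(S, T), mem_product.2 ⟨mem_filter.2 ⟨mem_univ _, hS⟩, mem_filter.2 ⟨mem_univ _, hT⟩⟩,
      q, (div_lt_iff₀' (by positivity)).2 hq⟩
  calc μ.real {ω | ¬ Discrepancy ρ (r + 1) (A ω)}
      ≤ μ.real (⋃ x ∈ 𝒮 ×ˢ 𝒮, bad x) := measureReal_mono subset_iUnion (measure_ne_top _ _)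
    _ ≤ ∑ x ∈ 𝒮 ×ˢ 𝒮, μ.real (bad x) := measureReal_biUnion_finset_le _ _
    _ ≤ ∑ x ∈ 𝒮 ×ˢ 𝒮, Real.exp (-((r + 1) * (e x.1 + e x.2))) := by
        refine sum_le_sum fun x _ => measureReal_exists_lt_le (Real.exp_pos _).le fun q => ?_
        have := he0 x.1
        have := he0 x.2
        exact hA.measureReal_lt_sum_product_le hp _ _ (by positivity) q
    _ = (∑ S ∈ 𝒮, Real.exp (-((r + 1) * e S))) * ∑ S ∈ 𝒮, Real.exp (-((r + 1) * e S)) := by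
        rw [sum_mul_sum, sum_product]
        simp only [mul_add, neg_add, Real.exp_add]
    _ ≤ Real.exp (-r) * Real.exp (-r) := by
        have := sum_nonempty_exp_neg_mul_subsetEntropy_le (Fin n) hr
        gcongr
    _ ≤ Real.exp (-r) * (1 / 2) := by
        gcongr
        exact exp_neg_le_half hr
    _ = Real.exp (-r) / 2 := by ring

lemma measureReal_le_sum_bilin_le (hA : IsInhomogeneousER μ p A) (hρ : 0 ≤ ρ)
    (hp : ∀ i j, p i j ≤ ρ) {R θ : ℝ} (hθ : 0 < θ) {a b : Fin n → ℝ} (ha : ∑ i, a i ^ 2 ≤ R)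
    (hb : ∑ i, b i ^ 2 ≤ R) {P : Finset (Fin n × Fin n)}
    (hP : ∀ x ∈ P, |a x.1 * b x.2| ≤ 1 / (2 * θ)) (t : ℝ) :
    μ.real {ω | t ≤ ∑ x ∈ P, a x.1 * b x.2 * (A ω - p) x.1 x.2} ≤
      Real.exp (2 * ρ * (θ * R) ^ 2 - θ * t) := by
  have hR : 0 ≤ R := (sum_nonneg fun i _ => sq_nonneg _).trans ha
  have term (x : Fin n × Fin n) (hx : x ∈ P) :
      p x.1 x.2 * ((Real.exp (2 * (θ * (a x.1 * b x.2))) - 1 - 2 * (θ * (a x.1 * b x.2))) / 2) ≤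
        2 * ρ * θ ^ 2 * (a x.1 ^ 2 * b x.2 ^ 2) := by
    have abs_le_one : |2 * (θ * (a x.1 * b x.2))| ≤ 1 := by
      rw [← mul_assoc, abs_mul, abs_of_pos (by positivity)]
      exact (le_div_iff₀' (by positivity)).1 (hP x hx)
    have exp_le := (le_abs_self _).trans (Real.abs_exp_sub_one_sub_id_le abs_le_one)
    calc _ ≤ p x.1 x.2 * ((2 * (θ * (a x.1 * b x.2))) ^ 2 / 2) := by
          gcongr
          exact hA.prob_nonneg _ _
      _ ≤ ρ * ((2 * (θ * (a x.1 * b x.2))) ^ 2 / 2) := by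
          gcongr
          exact hp _ _
      _ = _ := by ring
  have event_eq : {ω | t ≤ ∑ x ∈ P, a x.1 * b x.2 * (A ω - p) x.1 x.2} =
      {ω | θ * t ≤ ∑ x ∈ P, θ * (a x.1 * b x.2) * (A ω x.1 x.2 - p x.1 x.2)} := by
    simp only [mul_assoc θ, ← mul_sum, mul_le_mul_iff_right₀ hθ, Matrix.sub_apply]
  rw [event_eq]
  refine (hA.chernoff _ _ _).trans (Real.exp_le_exp.2 (sub_le_sub_right ?_ _))
  calc _ ≤ ∑ x ∈ P, 2 * ρ * θ ^ 2 * (a x.1 ^ 2 * b x.2 ^ 2) := sum_le_sum term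
    _ ≤ ∑ x : Fin n × Fin n, 2 * ρ * θ ^ 2 * (a x.1 ^ 2 * b x.2 ^ 2) :=
        sum_le_sum_of_subset_of_nonneg (subset_univ _) fun _ _ _ => by positivity
    _ = 2 * ρ * θ ^ 2 * ((∑ i, a i ^ 2) * ∑ i, b i ^ 2) := by
        rw [← mul_sum, sum_mul_sum, Fintype.sum_prod_type]
    _ ≤ 2 * ρ * θ ^ 2 * (R * R) := by
        gcongr
    _ = 2 * ρ * (θ * R) ^ 2 := by ring

lemma measureReal_le_sum_compl_heavyPairs_le (hA : IsInhomogeneousER μ p A) (hn : 1 ≤ n) {h : ℕ}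
    (hp : ∀ i j, p i j ≤ 4 ^ h / n) {a b : Fin n → ℤ} (ha : ∑ i, (a i : ℝ) ^ 2 ≤ 32 * n)
    (hb : ∑ i, (b i : ℝ) ^ 2 ≤ 32 * n) (K : ℝ) :
    μ.real {ω | 8 * K * 2 ^ h * n ≤
      ∑ x ∈ (heavyPairs h (fun i => (a i).natAbs) fun i => (b i).natAbs)ᶜ,
        (a x.1 * b x.2 : ℝ) * (A ω - p) x.1 x.2} ≤ Real.exp ((32 - K) * n) := by
  have : (0 : ℝ) < n := by exact_mod_cast hn
  refine (hA.measureReal_le_sum_bilin_le (by positivity) hp (θ := 1 / (8 * 2 ^ h)) (by positivity)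
    ha hb (fun x hx => ?_) _).trans_eq ?_
  · simp only [heavyPairs, mem_compl, mem_filter, mem_univ, true_and, not_lt] at hx
    have light : |(a x.1 : ℝ)| * |(b x.2 : ℝ)| ≤ 4 * 2 ^ h := by
      simp only [← Int.cast_abs, Int.abs_eq_natAbs, Int.cast_natCast]
      exact_mod_cast hx
    rw [abs_mul]
    refine light.trans_eq ?_
    field_simp
    norm_num
  · rw [show (4 : ℝ) ^ h = 2 ^ h * 2 ^ h by rw [← mul_pow]; norm_num]
    congr 1
    field_simp
    ring

lemma measureReal_not_lightBound_le (hA : IsInhomogeneousER μ p A) (hn : 1 ≤ n) {h : ℕ}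
    (hp : ∀ i j, p i j ≤ 4 ^ h / n) (hr : 1 ≤ r) :
    μ.real {ω | ¬ LightBound h (32 * n) (8 * (101 + r) * 2 ^ h * n) (A ω - p)} ≤
      Real.exp (-r) / 2 := by
  have hn' : (1 : ℝ) ≤ n := by exact_mod_cast hn
  set ℬ := latticeBall (Fin n) (32 * n)
  set bad : (Fin n → ℤ) × (Fin n → ℤ) → Set Ω := fun y => {ω | 8 * (101 + r) * 2 ^ h * n ≤
    ∑ x ∈ (heavyPairs h (fun i => (y.1 i).natAbs) fun i => (y.2 i).natAbs)ᶜ,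
      (y.1 x.1 * y.2 x.2 : ℝ) * (A ω - p) x.1 x.2}
  have subset_iUnion : {ω | ¬ LightBound h (32 * n) (8 * (101 + r) * 2 ^ h * n) (A ω - p)} ⊆
      ⋃ y ∈ ℬ ×ˢ ℬ, bad y := by
    intro ω hω
    simp only [LightBound, Set.mem_ofPred_eq, not_forall, not_le] at hω
    obtain ⟨a, b, ha, hb, hlt⟩ := hω
    simp only [Set.mem_iUnion]
    exact ⟨(a, b), mem_product.2 ⟨mem_latticeBall.2 ha, mem_latticeBall.2 hb⟩, hlt.le⟩
  have bad_le (y) (hy : y ∈ ℬ ×ˢ ℬ) : μ.real (bad y) ≤ Real.exp ((32 - (101 + r)) * n) := by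
    obtain ⟨ha, hb⟩ := mem_product.1 hy
    exact hA.measureReal_le_sum_compl_heavyPairs_le hn hp (mem_latticeBall.1 ha)
      (mem_latticeBall.1 hb) _
  have card_le : (ℬ.card : ℝ) ≤ Real.exp (34 * n) := by
    refine (card_latticeBall_le _).trans_eq ?_
    rw [Fintype.card_fin]
    ring_nf
  calc μ.real {ω | ¬ LightBound h (32 * n) (8 * (101 + r) * 2 ^ h * n) (A ω - p)}
      ≤ μ.real (⋃ y ∈ ℬ ×ˢ ℬ, bad y) := measureReal_mono subset_iUnion (measure_ne_top _ _)
    _ ≤ ∑ y ∈ ℬ ×ˢ ℬ, μ.real (bad y) := measureReal_biUnion_finset_le _ _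
    _ ≤ (ℬ.card * ℬ.card) * Real.exp ((32 - (101 + r)) * n) := by
        refine (sum_le_sum bad_le).trans_eq ?_
        rw [sum_const, card_product, nsmul_eq_mul, Nat.cast_mul]
    _ ≤ (Real.exp (34 * n) * Real.exp (34 * n)) * Real.exp ((32 - (101 + r)) * n) := by gcongr
    _ = Real.exp (-((1 + r) * n)) := by
        rw [← Real.exp_add, ← Real.exp_add]
        congr 1
        ring
    _ ≤ Real.exp (-r + -1) := Real.exp_le_exp.2 (by nlinarith)
    _ ≤ Real.exp (-r) * (1 / 2) := by
        rw [Real.exp_add]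
        gcongr
        exact exp_neg_le_half le_rfl
    _ = Real.exp (-r) / 2 := by ring

end IsInhomogeneousER

section HeavyPairs

variable {ι : Type*} [Fintype ι] {ρ K R E : ℝ} {A p : Matrix ι ι ℝ} {h : ℕ}

lemma neg_sum_heavyPairs_le (hp₀ : ∀ i j, 0 ≤ p i j) (hp : ∀ i j, p i j ≤ ρ) (hρ : 0 ≤ ρ)
    {a b : ι → ℤ} (ha : ∑ i, (a i : ℝ) ^ 2 ≤ R) (hb : ∑ i, (b i : ℝ) ^ 2 ≤ R) :
    -∑ x ∈ heavyPairs h (fun i => (a i).natAbs) fun i => (b i).natAbs,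
      (a x.1 * b x.2 : ℝ) * p x.1 x.2 ≤ ρ / (4 * 2 ^ h) * R ^ 2 := by
  have term (x) (hx : x ∈ heavyPairs h (fun i => (a i).natAbs) fun i => (b i).natAbs) :
      -((a x.1 * b x.2 : ℝ) * p x.1 x.2) ≤
        ρ / (4 * 2 ^ h) * ((a x.1 : ℝ) ^ 2 * (b x.2 : ℝ) ^ 2) := by
    have heavy : 4 * 2 ^ h ≤ |(a x.1 * b x.2 : ℝ)| := by
      simp only [abs_mul, ← Int.cast_abs, Int.abs_eq_natAbs, Int.cast_natCast]
      exact_mod_cast (mem_filter.1 hx).2.le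
    calc -((a x.1 * b x.2 : ℝ) * p x.1 x.2) ≤ |(a x.1 * b x.2 : ℝ)| * p x.1 x.2 := by
          rw [← neg_mul]
          exact mul_le_mul_of_nonneg_right (neg_le_abs _) (hp₀ _ _)
      _ ≤ |(a x.1 * b x.2 : ℝ)| * ρ := by
          gcongr
          exact hp _ _
      _ ≤ |(a x.1 * b x.2 : ℝ)| * (|(a x.1 * b x.2 : ℝ)| / (4 * 2 ^ h)) * ρ := by
          gcongr
          exact le_mul_of_one_le_right (abs_nonneg _) ((one_le_div (by positivity)).2 heavy)
      _ = ρ / (4 * 2 ^ h) * |(a x.1 * b x.2 : ℝ)| ^ 2 := by ring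
      _ = ρ / (4 * 2 ^ h) * ((a x.1 : ℝ) ^ 2 * (b x.2 : ℝ) ^ 2) := by rw [sq_abs, mul_pow]
  have hR : 0 ≤ R := (sum_nonneg fun i _ => sq_nonneg _).trans ha
  rw [← sum_neg_distrib]
  calc _ ≤ ∑ x : ι × ι, ρ / (4 * 2 ^ h) * ((a x.1 : ℝ) ^ 2 * (b x.2 : ℝ) ^ 2) :=
        (sum_le_sum term).trans <|
          sum_le_sum_of_subset_of_nonneg (subset_univ _) fun _ _ _ => by positivity
    _ = ρ / (4 * 2 ^ h) * ((∑ i, (a i : ℝ) ^ 2) * ∑ i, (b i : ℝ) ^ 2) := by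
        rw [← mul_sum, sum_mul_sum, Fintype.sum_prod_type]
    _ ≤ ρ / (4 * 2 ^ h) * (R * R) := by gcongr
    _ = ρ / (4 * 2 ^ h) * R ^ 2 := by ring

lemma Discrepancy.dotProduct_sub_mulVec_le [DecidableEq ι] (hA : Discrepancy ρ K A)
    (hA₀ : ∀ i j, 0 ≤ A i j) (hp₀ : ∀ i j, 0 ≤ p i j) (hp : ∀ i j, p i j ≤ ρ) (hρ : 0 ≤ ρ)
    (hK : 0 ≤ K) {X : ℝ}
    (hlight : LightBound h R X (A - p)) {a b : ι → ℤ} (ha : ∑ i, (a i : ℝ) ^ 2 ≤ R)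
    (hb : ∑ i, (b i : ℝ) ^ 2 ≤ R) (haE : ∑ x : ι × ι, (a x.1 : ℝ) ^ 2 * A x.1 x.2 ≤ E)
    (hbE : ∑ x : ι × ι, (b x.2 : ℝ) ^ 2 * A x.1 x.2 ≤ E) :
    (fun i => (a i : ℝ)) ⬝ᵥ (A - p) *ᵥ (fun i => (b i : ℝ)) ≤
      X + (4 * E / 2 ^ h + 4 * (3 * ρ / 2 ^ h * R ^ 2 +
        18 * K * 2 ^ h * (3 * R + 2 * Fintype.card ι))) + ρ / (4 * 2 ^ h) * R ^ 2 := by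
  set H := heavyPairs h (fun i => (a i).natAbs) fun i => (b i).natAbs
  have natAbs_sq (k : ℤ) : (k.natAbs : ℝ) ^ 2 = (k : ℝ) ^ 2 := by
    rw [Nat.cast_natAbs, Int.cast_abs, sq_abs]
  have heavy : ∑ x ∈ H, (a x.1 * b x.2 : ℝ) * A x.1 x.2 ≤ 4 * E / 2 ^ h +
      4 * (3 * ρ / 2 ^ h * R ^ 2 + 18 * K * 2 ^ h * (3 * R + 2 * Fintype.card ι)) := by
    refine (sum_le_sum fun x _ => ?_).trans <| hA.sum_heavyPairs_le hA₀ hρ hK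
      (α := fun i => (a i).natAbs) (β := fun i => (b i).natAbs) (by simpa only [natAbs_sq])
      (by simpa only [natAbs_sq]) (by simpa only [natAbs_sq]) (by simpa only [natAbs_sq]) h
    refine mul_le_mul_of_nonneg_right ((le_abs_self _).trans_eq ?_) (hA₀ _ _)
    simp only [abs_mul, Nat.cast_natAbs, Int.cast_abs]
  have split : (fun i => (a i : ℝ)) ⬝ᵥ (A - p) *ᵥ (fun i => (b i : ℝ)) =
      ∑ x ∈ Hᶜ, (a x.1 * b x.2 : ℝ) * (A - p) x.1 x.2 +
        ∑ x ∈ H, (a x.1 * b x.2 : ℝ) * A x.1 x.2 +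
        -∑ x ∈ H, (a x.1 * b x.2 : ℝ) * p x.1 x.2 := by
    rw [add_assoc, ← sub_eq_add_neg, ← sum_sub_distrib]
    simp only [← mul_sub, ← Matrix.sub_apply]
    rw [sum_compl_add_sum, Fintype.sum_prod_type]
    simp only [dotProduct, mulVec, mul_sum]
    exact sum_congr rfl fun i _ => sum_congr rfl fun j _ => by ring
  rw [split]
  exact add_le_add_three (hlight a b ha hb) heavy (neg_sum_heavyPairs_le hp₀ hp hρ ha hb)

lemma Discrepancy.sum_univ_le (hA : Discrepancy ρ K A) :
    ∑ x : ι × ι, A x.1 x.2 ≤ 3 * (ρ * Fintype.card ι ^ 2 + 2 * K * Fintype.card ι) := by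
  have entropy_univ : subsetEntropy (Fintype.card ι) (univ : Finset ι).card = Fintype.card ι := by
    rw [card_univ, subsetEntropy]
    rcases eq_or_ne (Fintype.card ι : ℝ) 0 with h0 | h0
    · rw [h0, zero_mul]
    · rw [div_self h0, Real.log_one, add_zero, mul_one]
  have := hA univ univ 0
  rw [univ_product_univ, entropy_univ, card_univ] at this
  norm_num at this
  linarith

end HeavyPairs

section DegreeWeight

variable {n : ℕ} {A p : Matrix (Fin n) (Fin n) ℝ} {D R : ℝ}

/-- Vertex weights which grow with the degree: in the norm `√(∑ i, g i * x i ^ 2)` given by these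
weights, vertices of degree much larger than `D` need no special treatment. -/
noncomputable def degreeWeight (D : ℝ) (A : Matrix (Fin n) (Fin n) ℝ) (i : Fin n) : ℝ :=
  1 + degree A i / D

lemma one_le_degreeWeight (hD : 0 ≤ D) (hA : ∀ i j, 0 ≤ A i j) (i : Fin n) :
    1 ≤ degreeWeight D A i :=
  le_add_of_nonneg_right (div_nonneg (degree_nonneg hA i) hD)

lemma sum_degreeWeight_le (hD : 0 < D) (hA : ∑ x : Fin n × Fin n, A x.1 x.2 ≤ D * n) :
    ∑ i, degreeWeight D A i ≤ 2 * n := by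
  rw [Fintype.sum_prod_type] at hA
  have : (∑ i, degree A i) / D ≤ n := (div_le_iff₀' hD).2 hA
  simp only [degreeWeight, sum_add_distrib, ← sum_div, sum_const, card_univ, Fintype.card_fin,
    nsmul_eq_mul, mul_one]
  linarith

lemma sum_sq_le_of_sum_degreeWeight_mul_sq_le (hD : 0 ≤ D) (hA : ∀ i j, 0 ≤ A i j) {x : Fin n → ℝ}
    (hx : ∑ i, degreeWeight D A i * x i ^ 2 ≤ R) : ∑ i, x i ^ 2 ≤ R :=
  (sum_le_sum fun i _ => le_mul_of_one_le_left (sq_nonneg _) (one_le_degreeWeight hD hA i)).trans hx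

lemma sum_sq_mul_le_of_sum_degreeWeight_mul_sq_le (hD : 0 < D) {x : Fin n → ℝ}
    (hx : ∑ i, degreeWeight D A i * x i ^ 2 ≤ R) :
    ∑ y : Fin n × Fin n, x y.1 ^ 2 * A y.1 y.2 ≤ D * R := by
  calc ∑ y : Fin n × Fin n, x y.1 ^ 2 * A y.1 y.2 = ∑ i, x i ^ 2 * degree A i := by
        simp only [Fintype.sum_prod_type, degree, mul_sum]
    _ ≤ ∑ i, D * (degreeWeight D A i * x i ^ 2) := sum_le_sum fun i _ => by
        rw [degreeWeight, ← mul_assoc, mul_one_add, mul_div_cancel₀ _ hD.ne', mul_comm]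
        gcongr
        exact le_add_of_nonneg_left hD.le
    _ ≤ D * R := by
        rw [← mul_sum]
        gcongr

lemma mul_degreeWeight_le_degree_regularize {τ : ℝ} (hD : 0 < D) (hτ : τ ≤ D)
    (hA : ∀ i j, 0 ≤ A i j) (i : Fin n) : τ * degreeWeight D A i ≤ degree (regularize τ A) i := by
  have : τ / D * degree A i ≤ 1 * degree A i :=
    mul_le_mul_of_nonneg_right ((div_le_one hD).2 hτ) (degree_nonneg hA i)
  rw [degree_regularize, degreeWeight]
  linarith [show τ * (1 + degree A i / D) = τ + τ / D * degree A i by ring]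

lemma Discrepancy.sum_le {h : ℕ} {r : ℝ} (hn : 1 ≤ n) (hr : 1 ≤ r)
    (hA : Discrepancy (4 ^ h / n) (r + 1) A) :
    ∑ x : Fin n × Fin n, A x.1 x.2 ≤ 15 * r * 4 ^ h * n := by
  have : (0 : ℝ) < n := by exact_mod_cast hn
  have one_le_pow : (1 : ℝ) ≤ 4 ^ h := one_le_pow₀ (by norm_num)
  calc ∑ x : Fin n × Fin n, A x.1 x.2 ≤ 3 * (4 ^ h / n * n ^ 2 + 2 * (r + 1) * n) := by
        simpa only [Fintype.card_fin] using hA.sum_univ_le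
    _ = (3 * 4 ^ h + 6 * (r + 1)) * n := by field_simp; ring
    _ ≤ 15 * r * 4 ^ h * n := by
        gcongr
        nlinarith

lemma formBound_degreeWeight_sub {h : ℕ} {r : ℝ} (hn : 1 ≤ n) (hr : 1 ≤ r)
    (hA₀ : ∀ i j, 0 ≤ A i j) (hA : A.IsSymm) (hp₀ : ∀ i j, 0 ≤ p i j)
    (hp : ∀ i j, p i j ≤ 4 ^ h / n) (hdisc : Discrepancy (4 ^ h / n) (r + 1) A)
    (hlight : LightBound h (32 * n) (8 * (101 + r) * 2 ^ h * n) (A - p))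
    (hsum : ∑ i, degreeWeight (15 * r * 4 ^ h) A i ≤ 2 * n) :
    FormBound (degreeWeight (15 * r * 4 ^ h) A) (2000 * r * 2 ^ h) (A - p) := by
  have : (0 : ℝ) < n := by exact_mod_cast hn
  have hD : 0 < 15 * r * 4 ^ h := by positivity
  have four_pow : (4 : ℝ) ^ h = 2 ^ h * 2 ^ h := by rw [← mul_pow]; norm_num
  rw [show 2000 * r * 2 ^ h = 2 * (1000 * r * 2 ^ h) by ring]
  refine FormBound.of_lattice (R := 32 * n)
    (fun i => one_pos.trans_le (one_le_degreeWeight hD.le hA₀ i)) (by positivity) (by linarith)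
    fun a b ha hb => ?_
  have hbE : ∑ x : Fin n × Fin n, (b x.2 : ℝ) ^ 2 * A x.1 x.2 ≤ 15 * r * 4 ^ h * (32 * n) := by
    rw [← (Equiv.prodComm _ _).sum_comp]
    simpa only [Equiv.prodComm_apply, Prod.fst_swap, Prod.snd_swap, hA.apply] using
      sum_sq_mul_le_of_sum_degreeWeight_mul_sq_le hD hb
  refine (hdisc.dotProduct_sub_mulVec_le hA₀ hp₀ hp (by positivity) (by linarith) hlight
    (sum_sq_le_of_sum_degreeWeight_mul_sq_le hD.le hA₀ ha)
    (sum_sq_le_of_sum_degreeWeight_mul_sq_le hD.le hA₀ hb)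
    (sum_sq_mul_le_of_sum_degreeWeight_mul_sq_le hD ha) hbE).trans ?_
  rw [four_pow, Fintype.card_fin]
  calc _ = (8 * (101 + r) + 1920 * r + 12288 + 7056 * (r + 1) + 256) * (2 ^ h * n) := by
        field_simp
        ring
    _ ≤ 32000 * r * (2 ^ h * n) := by
        gcongr
        linarith
    _ = _ := by ring

end DegreeWeight

section Deterministic

variable {n : ℕ} {A p : Matrix (Fin n) (Fin n) ℝ} {τ d r : ℝ} {h : ℕ}

lemma specNorm_laplacian_regularize_sub_le (hτ : 0 < τ) (hd : 0 ≤ d) (hr : 1 ≤ r)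
    (hA₀ : ∀ i j, 0 ≤ A i j) (hp₀ : ∀ i j, 0 ≤ p i j) (hp : ∀ i j, p i j ≤ d / n)
    (hh : d + τ ≤ 4 ^ h) (hh' : (4 : ℝ) ^ h ≤ 4 * (d + τ))
    (hsum : ∑ i, degreeWeight (15 * r * 4 ^ h) A i ≤ 2 * n)
    (hform : FormBound (degreeWeight (15 * r * 4 ^ h) A) (2000 * r * 2 ^ h) (A - p)) :
    specNorm (laplacian (regularize τ A) - laplacian (regularize τ p)) ≤
      20000 * r / √τ * (1 + d / τ) ^ (3 / 2 : ℝ) := by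
  set D : ℝ := 15 * r * 4 ^ h
  set s : ℝ := 1 + d / τ with hs
  have hs1 : 1 ≤ s := le_add_of_nonneg_right (by positivity)
  have add_eq : d + τ = τ * s := by rw [hs]; field_simp; ring
  have τ_le_D : τ ≤ D := by nlinarith [show (0 : ℝ) < 4 ^ h by positivity]
  have two_pow_le : (2 : ℝ) ^ h ≤ 2 * (√τ * √s) := by
    refine le_of_sq_le_sq ?_ (by positivity)
    rw [mul_pow, mul_pow, Real.sq_sqrt hτ.le, Real.sq_sqrt (by positivity), ← add_eq, ← pow_mul,
      mul_comm h, pow_mul]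
    norm_num
    exact hh'
  have entry_le (i j : Fin n) : |regularize τ p i j| ≤ (d + τ) / n := by
    have := hp₀ i j
    rw [regularize_apply, abs_of_nonneg (by positivity), add_div]
    gcongr
    exact hp i j
  calc _ ≤ 2000 * r * 2 ^ h / τ + 4 * (d + τ) * (2000 * r * 2 ^ h) / τ ^ 2 :=
        specNorm_laplacian_sub_le hτ (by positivity) (by positivity)
          (one_le_degreeWeight (by positivity) hA₀) hsum
          (mul_degreeWeight_le_degree_regularize (by positivity) τ_le_D hA₀)
          (fun i => by rw [degree_regularize]; linarith [degree_nonneg hp₀ i]) entry_le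
          (by rwa [regularize_sub_regularize])
    _ = 2000 * r * (1 + 4 * s) / τ * 2 ^ h := by
        rw [add_eq]
        field_simp
    _ ≤ 2000 * r * (s + 4 * s) / τ * (2 * (√τ * √s)) := by gcongr
    _ = 20000 * r / √τ * (s * √s) := by
        nth_rw 1 [← Real.sq_sqrt hτ.le]
        field_simp
        ring
    _ = 20000 * r / √τ * s ^ (3 / 2 : ℝ) := by
        rw [show (3 / 2 : ℝ) = 1 + 1 / 2 by norm_num, Real.rpow_add (by positivity), Real.rpow_one,
          Real.sqrt_eq_rpow s]

lemma specNorm_laplacian_regularize_sub_le_of_le_one (hτ : 0 < τ) (hτ' : τ ≤ 1) (hd : 0 ≤ d)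
    (hr : 1 ≤ r) (hA₀ : ∀ i j, 0 ≤ A i j) (hA : A.IsSymm) (hp₀ : ∀ i j, 0 ≤ p i j)
    (hp : p.IsSymm) : specNorm (laplacian (regularize τ A) - laplacian (regularize τ p)) ≤
      20000 * r / √τ * (1 + d / τ) ^ (3 / 2 : ℝ) := by
  have one_le_div : 1 ≤ r / √τ :=
    (one_le_div (by positivity)).2 ((Real.sqrt_le_one.2 hτ').trans hr)
  have one_le_rpow : (1 : ℝ) ≤ (1 + d / τ) ^ (3 / 2 : ℝ) :=
    Real.one_le_rpow (le_add_of_nonneg_right (by positivity)) (by norm_num)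
  calc _ ≤ (2 : ℝ) := specNorm_laplacian_sub_laplacian_le_two
        (regularize_nonneg hτ.le hA₀) (isSymm_regularize hA)
        (regularize_nonneg hτ.le hp₀) (isSymm_regularize hp)
    _ ≤ 20000 * (r / √τ * (1 + d / τ) ^ (3 / 2 : ℝ)) := by
        linarith [one_le_mul_of_one_le_of_one_le one_le_div one_le_rpow]
    _ = _ := by ring

lemma mul_rpow_three_halves_le_mul_rpow_five_halves (hτ : 0 < τ) (hd : 0 ≤ d) (hr : 1 ≤ r) {C : ℝ}
    (hC : 0 ≤ C) : C * r / √τ * (1 + d / τ) ^ (3 / 2 : ℝ) ≤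
      C * r ^ 2 / √τ * (1 + d / τ) ^ (5 / 2 : ℝ) := by
  gcongr
  · exact le_self_pow₀ hr two_ne_zero
  · exact le_add_of_nonneg_right (by positivity)
  · norm_num

lemma maxDeg_nonneg (hp : ∀ i j, 0 ≤ p i j) : 0 ≤ maxDeg p :=
  Real.iSup_nonneg fun _ => mul_nonneg n.cast_nonneg (hp _ _)

lemma le_maxDeg (p : Matrix (Fin n) (Fin n) ℝ) (i j : Fin n) : n * p i j ≤ maxDeg p :=
  le_ciSup (f := fun e : Fin n × Fin n => n * p e.1 e.2) (Set.finite_range _).bddAbove (i, j)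

lemma exists_four_pow_mem_Icc {x : ℝ} (hx : 1 ≤ x) : ∃ h : ℕ, x ≤ 4 ^ h ∧ (4 : ℝ) ^ h ≤ 4 * x := by
  obtain ⟨k, hk, hk'⟩ := exists_nat_pow_near hx (by norm_num : (1 : ℝ) < 4)
  exact ⟨k + 1, hk'.le, by rw [pow_succ']; gcongr⟩

end Deterministic

namespace IsInhomogeneousER

variable {Ω : Type*} [MeasurableSpace Ω] {μ : Measure Ω} [IsProbabilityMeasure μ] {n : ℕ}
  {p : Matrix (Fin n) (Fin n) ℝ} {A : Ω → Matrix (Fin n) (Fin n) ℝ} {τ r : ℝ}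

lemma le_measureReal_formBound (hA : IsInhomogeneousER μ p A) (hn : 1 ≤ n) {h : ℕ}
    (hp : ∀ i j, p i j ≤ 4 ^ h / n) (hr : 1 ≤ r) :
    1 - Real.exp (-r) ≤ μ.real {ω | ∑ i, degreeWeight (15 * r * 4 ^ h) (A ω) i ≤ 2 * n ∧
      FormBound (degreeWeight (15 * r * 4 ^ h) (A ω)) (2000 * r * 2 ^ h) (A ω - p)} := by
  have : (0 : ℝ) < n := by exact_mod_cast hn
  set dense := {ω | ¬ Discrepancy (4 ^ h / n) (r + 1) (A ω)}
  set large := {ω | ¬ LightBound h (32 * n) (8 * (101 + r) * 2 ^ h * n) (A ω - p)}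
  set good := {ω | ∑ i, degreeWeight (15 * r * 4 ^ h) (A ω) i ≤ 2 * n ∧
    FormBound (degreeWeight (15 * r * 4 ^ h) (A ω)) (2000 * r * 2 ^ h) (A ω - p)}
  have univ_subset : Set.univ ⊆ good ∪ (dense ∪ large) := by
    intro ω _
    by_cases hdisc : Discrepancy (4 ^ h / n) (r + 1) (A ω)
    · by_cases hlight : LightBound h (32 * n) (8 * (101 + r) * 2 ^ h * n) (A ω - p)
      · have hsum := sum_degreeWeight_le (by positivity) (hdisc.sum_le hn hr)
        exact Or.inl ⟨hsum, formBound_degreeWeight_sub hn hr (hA.entry_nonneg ω) (hA.symm ω)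
          hA.prob_nonneg hp hdisc hlight hsum⟩
      · exact Or.inr (Or.inr hlight)
    · exact Or.inr (Or.inl hdisc)
  calc 1 - Real.exp (-r)
      = μ.real (good ∪ (dense ∪ large)) - (Real.exp (-r) / 2 + Real.exp (-r) / 2) := by
        rw [Set.univ_subset_iff.1 univ_subset, probReal_univ, add_halves]
    _ ≤ μ.real (good ∪ (dense ∪ large)) - (μ.real dense + μ.real large) :=
        sub_le_sub_left (add_le_add (hA.measureReal_not_discrepancy_le hp hr)
          (hA.measureReal_not_lightBound_le hn hp hr)) _
    _ ≤ μ.real good := by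
        linarith [measureReal_union_le (μ := μ) good (dense ∪ large),
          measureReal_union_le (μ := μ) dense large]

lemma le_measureReal_specNorm_of_one_le (hA : IsInhomogeneousER μ p A) (hn : 1 ≤ n) (hτ : 1 ≤ τ)
    (hr : 1 ≤ r) : 1 - Real.exp (-r) ≤
      μ.real {ω | specNorm (laplacian (regularize τ (A ω)) - laplacian (regularize τ p)) ≤
        20000 * r / √τ * (1 + maxDeg p / τ) ^ (3 / 2 : ℝ)} := by
  have hn' : (0 : ℝ) < n := by exact_mod_cast hn
  have hd := maxDeg_nonneg hA.prob_nonneg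
  have hp (i j) : p i j ≤ maxDeg p / n := (le_div_iff₀' hn').2 (le_maxDeg p i j)
  obtain ⟨h, hh, hh'⟩ := exists_four_pow_mem_Icc (by linarith : 1 ≤ maxDeg p + τ)
  have hp' (i j) : p i j ≤ 4 ^ h / n := (hp i j).trans (by gcongr; linarith)
  refine (hA.le_measureReal_formBound hn hp' hr).trans (measureReal_mono fun ω hω => ?_)
  exact specNorm_laplacian_regularize_sub_le (by linarith) hd hr (hA.entry_nonneg ω)
    hA.prob_nonneg hp hh hh' hω.1 hω.2

end IsInhomogeneousER

end RegLap

theorem mainTheorem2_general :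
    ∃ C : ℝ, 0 < C ∧
      ∀ (n : ℕ), 1 ≤ n →
      ∀ (Ω : Type*) [MeasurableSpace Ω] (μ : Measure Ω) [IsProbabilityMeasure μ]
        (p : Matrix (Fin n) (Fin n) ℝ) (A : Ω → Matrix (Fin n) (Fin n) ℝ),
        RegLap.IsInhomogeneousER μ p A →
      ∀ τ : ℝ, 0 < τ → ∀ r : ℝ, 1 ≤ r →
        1 - Real.exp (-r) ≤
          μ.real {ω |
            RegLap.specNorm
                (RegLap.laplacian (RegLap.regularize τ (A ω)) -
                  RegLap.laplacian
                    (RegLap.expectation μ fun ω' => RegLap.regularize τ (A ω'))) ≤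
              C * r / √τ * (1 + RegLap.maxDeg p / τ) ^ (3 / 2 : ℝ)} := by
  refine ⟨20000, by norm_num, fun n hn Ω _ μ _ p A hA τ hτ r hr => ?_⟩
  rw [hA.expectation_regularize]
  obtain hτ' | hτ' := le_total 1 τ
  · exact hA.le_measureReal_specNorm_of_one_le hn hτ' hr
  · simp only [RegLap.specNorm_laplacian_regularize_sub_le_of_le_one hτ hτ'
      (RegLap.maxDeg_nonneg hA.prob_nonneg) hr (hA.entry_nonneg _) (hA.symm _) hA.prob_nonneg
      hA.prob_symm, Set.ofPred_true, probReal_univ, sub_le_self_iff]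
    positivity

theorem mainTheorem2 :
    ∃ C : ℝ, 0 < C ∧
      ∀ (n : ℕ), 1 ≤ n →
      ∀ (Ω : Type*) [MeasurableSpace Ω] (μ : Measure Ω) [IsProbabilityMeasure μ]
        (p : Matrix (Fin n) (Fin n) ℝ) (A : Ω → Matrix (Fin n) (Fin n) ℝ),
        RegLap.IsInhomogeneousER μ p A →
      ∀ τ : ℝ, 0 < τ → ∀ r : ℝ, 1 ≤ r →
        1 - Real.exp (-r) ≤
          μ.real {ω |
            RegLap.specNorm
                (RegLap.laplacian (RegLap.regularize τ (A ω)) -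
                  RegLap.laplacian
                    (RegLap.expectation μ fun ω' => RegLap.regularize τ (A ω'))) ≤
              C * r ^ 2 / √τ * (1 + RegLap.maxDeg p / τ) ^ (5 / 2 : ℝ)} := by
  obtain ⟨C, hC, h⟩ := mainTheorem2_general
  exact ⟨C, hC, fun n hn Ω _ μ _ p A hA τ hτ r hr => (h n hn Ω μ p A hA τ hτ r hr).trans <|
    measureReal_mono fun _ hω => hω.trans <|
      RegLap.mul_rpow_three_halves_le_mul_rpow_five_halves hτ
        (RegLap.maxDeg_nonneg hA.prob_nonneg) hr hC.le⟩
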